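/- Notation. For $\gamma=\begin{pmatrix}a&b\\c&d\end{pmatrix}\in GL_2^+(\mathbb R)$ and a function $g$ on the upper half plane $\mathcal H$ put $(g|\gamma)(z)=\det(\gamma)\,(cz+d)^{-2}g(\gamma z)$. Put $\nu(n)=\sum_{p\mid n}v_p(n)$, $\mu(n)=\prod_{p\mid n}(p+1)$ (not the Möbius function), let $\varphi$ be Euler's function, and let $B_2(t)=\langle t\rangle^2-\langle t\rangle+\frac16$ with $\langle t\rangle$ the fractional part of $t$. For $\underline x=(x_1,x_2)\in(\mathbb Q/\mathbb Z)^2$ let $\phi_{\underline x}$ be Hecke's function on $\mathcal H$, $$\phi_{\underline x}(z)=-\delta(\underline x)\frac{i}{2\pi(z-\overline z)}+\tfrac12B_2(x_1)-P_{\underline x}(z)-P_{-\underline x}(z),\qquad P_{\underline x}(z)=\sum_{k\in\mathbb Q_{>0},\,k\equiv x_1(1)}k\sum_{m\ge1}e^{2\pi im(kz+x_2)},$$ where $\delta(\underline x)=1$ if $\underline x=0$ and $\delta(\underline x)=0$ otherwise. Let $D$ be a positive square-free integer and $C$ a positive divisor of $D$. Let $M,L$ be positive divisors of $D$ with $M\neq1$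 and $D\mid ML\mid DC$, and let $\psi$ be a Dirichlet character modulo $(M,L)$ that is quadratic, i.e. takes only the values $0,\pm1$ (the trivial character is allowed). Let $f$ be its conductor; regard $\psi$ as a primitive character modulo $f$, with $\psi(n)=0$ if $(n,f)\ne1$, and let $g(\psi)=\sum_{a\bmod f}\psi(a)e^{2\pi ia/f}$. Put $$E_\psi=-\frac1{2g(\psi)}\sum_{a\in(\mathbb Z/f)^\times}\sum_{b\in(\mathbb Z/f^2)^\times}\psi(a)\psi(b)\,\phi_{(\frac af,\frac b{f^2})},\qquad n_\psi=-\frac f{4g(\psi)}\sum_{a,b\in\mathbb Z/f}\psi(a)\psi(b)B_2\!\left(\tfrac{a+b}f\right),$$ and $$E_{M,L,\psi}=\prod_{p\mid L/f}\left(1-p^{-1}\psi^{-1}(p)\gamma_p\right)\prod_{p\mid M/f}\left(1-\psi(p)\gamma_p\right)E_\psi,\qquad \gamma_p(g)=g\,|\begin{pmatrix}p&0\\0&1\end{pmatrix}.$$ Proposition. Let $r\mid D/C$ and $s,t\mid C$ be positive divisors with $(s,t)=1$, and let $x$ be an integer prime to $D$. Then the constant term of $E_{M,L,\psi}$ at the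 cusp $\left[\frac{rs^2tx}{DC}\right]$ of $X_0(DC)$ (that is, the constant term of the Fourier expansion of $E_{M,L,\psi}|\gamma$ for any $\gamma\in SL_2(\mathbb Z)$ mapping $\infty$ to this cusp) is $$a_0\!\left(E_{M,L,\psi};\left[\tfrac{rs^2tx}{DC}\right]\right)=\begin{cases}n_\psi\cdot\dfrac{\varphi(D/f)\,\mu(L/f)}{L/f}\cdot c_{rstx}&\text{if }(s,f)=1,\ (M,L)\mid st\text{ and }\frac DM\mid rs,\\[2mm]0&\text{otherwise,}\end{cases}$$ where $$c_{rstx}=\frac{(-1)^{\nu\left(\frac D{frs}\right)}\,\psi\!\left(\frac{DC}{frs^2tx}\right)}{rs}\prod_{p\mid\left(s,\frac{(M,L)}f\right)}\left(1-\frac1p\right)$$ and $\psi(y/x)=\psi(y)\psi^{-1}(x)$. (In the first case $frs\mid D$ and $frs^2t\mid DC$.) -/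

import Mathlib

namespace QuadEis

noncomputable section

open Complex Matrix Matrix.SpecialLinearGroup OnePoint
open scoped ModularForm MatrixGroups UpperHalfPlane

/-! ### Hecke's functions of weight two -/

/-- The periodic second Bernoulli function `B₂(t) = ⟨t⟩² - ⟨t⟩ + 1/6`. -/
def B2 (t : ℚ) : ℚ := Int.fract t ^ 2 - Int.fract t + 1 / 6

/-- `P_{(x₁, x₂)}(z) = ∑_{k ∈ ℚ, k > 0, k ≡ x₁ mod 1} k ∑_{m ≥ 1} exp (2 π i m (k z + x₂))`. -/
def P (x₁ x₂ : ℚ) (z : ℍ) : ℂ :=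
  ∑' k : {k : ℚ // 0 < k ∧ ∃ n : ℤ, k = x₁ + n},
    ((k : ℚ) : ℂ) * ∑' m : ℕ+, cexp (2 * Real.pi * I * (m : ℂ) * (((k : ℚ) : ℂ) * z + (x₂ : ℂ)))

/-- `δ(x)` is `1` if `x = 0` in `(ℚ/ℤ)²` and `0` otherwise. -/
def delta (x₁ x₂ : ℚ) : ℂ := if Int.fract x₁ = 0 ∧ Int.fract x₂ = 0 then 1 else 0

/-- Hecke's function `φ_x` on the upper half plane, where `x = (x₁, x₂)` is a representative in
`ℚ²` of a class in `(ℚ/ℤ)²`: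
`φ_x(z) + δ(x) i / (2 π (z - z̄)) = B₂(x₁) / 2 - P_x(z) - P_{-x}(z)`. -/
def phi (x₁ x₂ : ℚ) (z : ℍ) : ℂ :=
  1 / 2 * (B2 x₁ : ℂ) - P x₁ x₂ z - P (-x₁) (-x₂) z
    - delta x₁ x₂ * (I / (2 * Real.pi * ((z : ℂ) - (starRingEnd ℂ) (z : ℂ))))

/-! ### The operators `[M]^±_ψ`

Here `χ` is the character modulo its conductor `f`. -/

/-- `γ_p : g ↦ g | diag(p, 1)`, the weight-two slash action (only used for `p` prime). -/
def gammaOp (p : ℕ) (g : ℍ → ℂ) : ℍ → ℂ :=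
  if hp : (p : ℝ) ≠ 0 then
    g ∣[(2 : ℤ)] (Matrix.GeneralLinearGroup.mkOfDetNeZero !![(p : ℝ), 0; 0, 1]
      (by simpa [Matrix.det_fin_two] using hp) : GL (Fin 2) ℝ)
  else 0

/-- `[p]⁺_χ = 1 - χ(p) γ_p`. -/
def plusOp {f : ℕ} (χ : DirichletCharacter ℂ f) (p : ℕ) (g : ℍ → ℂ) : ℍ → ℂ :=
  g - χ (p : ZMod f) • gammaOp p g

/-- `[p]⁻_χ = 1 - p⁻¹ χ⁻¹(p) γ_p`. -/
def minusOp {f : ℕ} (χ : DirichletCharacter ℂ f) (p : ℕ) (g : ℍ → ℂ) : ℍ → ℂ :=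
  g - ((p : ℂ)⁻¹ * χ⁻¹ (p : ZMod f)) • gammaOp p g

/-- `[K]⁺_χ`, the composition of the `[p]⁺_χ` over the primes `p ∣ K` (`K` square-free). -/
def plusOpProd {f : ℕ} (χ : DirichletCharacter ℂ f) (K : ℕ) (g : ℍ → ℂ) : ℍ → ℂ :=
  K.primeFactorsList.foldr (plusOp χ) g

/-- `[K]⁻_χ`, the composition of the `[p]⁻_χ` over the primes `p ∣ K` (`K` square-free). -/
def minusOpProd {f : ℕ} (χ : DirichletCharacter ℂ f) (K : ℕ) (g : ℍ → ℂ) : ℍ → ℂ :=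
  K.primeFactorsList.foldr (minusOp χ) g

/-! ### The Eisenstein series -/

instance neZero_gcd (M L : ℕ) [NeZero M] : NeZero (Nat.gcd M L) :=
  ⟨fun h => NeZero.ne M (Nat.gcd_eq_zero_iff.mp h).1⟩

instance neZero_conductor {n : ℕ} [NeZero n] (ψ : DirichletCharacter ℂ n) : NeZero ψ.conductor :=
  ⟨ψ.conductor_ne_zero⟩

/-- The Gauss sum `g(χ) = ∑_{a mod f} χ(a) exp (2 π i a / f)`. -/
def gauss {f : ℕ} [NeZero f] (χ : DirichletCharacter ℂ f) : ℂ := gaussSum χ ZMod.stdAddChar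

/-- `E_χ = -1/(2 g(χ)) ∑_{a ∈ (ℤ/f)ˣ} ∑_{b ∈ (ℤ/f²)ˣ} χ(a) χ(b) φ_{(a/f, b/f²)}` for a primitive
character `χ` modulo `f`. -/
def EPrim {f : ℕ} [NeZero f] (χ : DirichletCharacter ℂ f) : ℍ → ℂ := fun z =>
  -1 / (2 * gauss χ) *
    ∑ a ∈ (Finset.range f).filter (fun a => a.Coprime f),
      ∑ b ∈ (Finset.range (f ^ 2)).filter (fun b => b.Coprime (f ^ 2)),
        χ (a : ZMod f) * χ (b : ZMod f) * phi ((a : ℚ) / f) ((b : ℚ) / (f : ℚ) ^ 2) z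

/-- `E_{M,L,ψ} = [L/f]⁻_ψ ∘ [M/f]⁺_ψ (E_ψ)` for a character `ψ` modulo `(M, L)` of conductor `f`. -/
def E (M L : ℕ) [NeZero M] (ψ : DirichletCharacter ℂ (Nat.gcd M L)) : ℍ → ℂ :=
  minusOpProd ψ.primitiveCharacter (L / ψ.conductor)
    (plusOpProd ψ.primitiveCharacter (M / ψ.conductor) (EPrim ψ.primitiveCharacter))

/-- The conditions on `(M, L)` in the index set `ℋ(DC)`; the third entry of a triple in `ℋ(DC)`
is then any Dirichlet character modulo `(M, L)`. -/
structure IsIndexPair (D C M L : ℕ) : Prop where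
  dvd_left : M ∣ D
  dvd_right : L ∣ D
  ne_one : M ≠ 1
  dvd_mul : D ∣ M * L
  mul_dvd : M * L ∣ D * C

/-! ### Constant terms at cusps -/

/-- `v` is the constant term of (the Fourier expansion of) `g` at the cusp `[q]` of `X₀(N)`, for a
rational number `q`: for every `γ ∈ SL₂(ℤ)` such that `γ ∞` is `Γ₀(N)`-equivalent to `q`, the
function `g | γ` (in weight two) has an expansion `∑_{n ≥ 0} a_n exp (2 π i n z / h)` for some
integer `h ≥ 1`, and `a_0 = v`. -/
def IsConstantTermAt (N : ℕ) (g : ℍ → ℂ) (q : ℚ) (v : ℂ) : Prop :=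
  ∀ γ : SL(2, ℤ),
    (∃ δ ∈ CongruenceSubgroup.Gamma0 N,
      (mapGL ℚ (δ * γ) : GL (Fin 2) ℚ) • (∞ : OnePoint ℚ) = (q : OnePoint ℚ)) →
    ∃ h : ℕ, 0 < h ∧ ∃ a : ℕ → ℂ, a 0 = v ∧
      ∀ z : ℍ, HasSum (fun n : ℕ => a n * cexp (2 * Real.pi * I * (n : ℂ) * (z : ℂ) / (h : ℂ)))
        ((g ∣[(2 : ℤ)] γ) z)

/-! ### The quantities in the formula -/

/-- `ν(n) = ∑_{p ∣ n} v_p(n)`. -/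
def nu (n : ℕ) : ℕ := ArithmeticFunction.cardFactors n

/-- `μ(n) = ∏_{p ∣ n} (p + 1)` (not the Möbius function). -/
def mu (n : ℕ) : ℕ := ∏ p ∈ n.primeFactors, (p + 1)

/-- `n_χ = -f/(4 g(χ)) ∑_{a, b ∈ ℤ/f} χ(a) χ(b) B₂((a + b)/f)` for a primitive character `χ`
modulo `f`. -/
def nConst {f : ℕ} [NeZero f] (χ : DirichletCharacter ℂ f) : ℂ :=
  -(f : ℂ) / (4 * gauss χ) *
    ∑ a ∈ Finset.range f, ∑ b ∈ Finset.range f,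
      χ (a : ZMod f) * χ (b : ZMod f) * (B2 (((a : ℚ) + b) / f) : ℂ)

/-- `c_{rstx} = (-1)^{ν(D/(frs))} χ(DC/(f r s² t x)) / (r s) ∏_{p ∣ (s, (M,L)/f)} (1 - 1/p)`, with
`χ(y/x) = χ(y) χ⁻¹(x)`. It is only used when `(s, f) = 1` and `(M, L) ∣ s t`, and then (`D` being
square-free and `f ∣ (M, L)`) the divisions of natural numbers are exact. -/
def cConst {f : ℕ} (χ : DirichletCharacter ℂ f) (D C M L r s t : ℕ) (x : ℤ) : ℂ :=
  (-1) ^ nu (D / (f * r * s)) *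
      (χ ((D * C / (f * r * s ^ 2 * t) : ℕ) : ZMod f) * χ⁻¹ (x : ZMod f)) / ((r : ℂ) * s) *
    ∏ p ∈ (Nat.gcd s (Nat.gcd M L / f)).primeFactors, (1 - 1 / (p : ℂ))

end

end QuadEis

namespace QuadEis
open Complex Matrix Matrix.SpecialLinearGroup OnePoint
open scoped ModularForm MatrixGroups UpperHalfPlane

/-! Write χ, of conductor f, for the primitive character inducing ψ. Because χ is quadratic, E_χ is
a twist of level one: it equals g(χ)⁻¹ ∑_u χ(u) `eisStar` | (f u; 0 f) (`EPrim_eq`), both sides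
being governed by the series ∑ χ(jm) j q^{jm}. So no transformation law for the functions φ_x is
needed.

Since `eisStar` is invariant under SL₂(ℤ), row reduction gives the constant term of `eisStar` | A
for any integral A of positive determinant: -1/24 times the squared gcd of the first column, divided
by det A (`hasExpansion_eisStar_slash`). If γ has first column (a, c), the constant term of E_χ |
diag(d, 1) γ is therefore a character sum of squared gcds. Orthogonality evaluates it
(`sum_char_gcd_sq`): it vanishes unless gcd(c, f²) = f, and otherwise contains Jordan's totient
J₂(f). The Bernoulli sum in n_χ contains the same J₂(f) (`nConst_eq`), which leaves n_χ χ(a) χ(c/f)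
· χ(d) d⁻¹ gcd(d, c)².

The operator γ_p replaces d by pd. As χ(p)² = 1, the operators [p]⁺ and [p]⁻ turn a weight W(d) into
W(d) - p⁻¹ W(pd) and W(d) - p⁻² W(pd). Starting from gcd(d, c)² this yields a product of local
factors, which at d = 1 depend only on whether p and p² divide c (`hasExpansion_stabilised`). The
1/Im z terms cancel because ∑ χ(u) = 0 if f > 1, and because 1 - χ(p) = 0 for a prime p ∣ M if f =
1.

At the given cusp these divisibilities are read off from r, s, t (`cusp_denominator`). The product
of local factors is then computed prime by prime (`prod_localFactor_eq`); where the stated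
conditions fail, either gcd(c, f²) ≠ f or some local factor is zero. -/

/-! ### The invariant Eisenstein series of level one -/

/-- The nonholomorphic Eisenstein series of weight two and level one. -/
noncomputable def eisStar (z : ℍ) : ℂ := -1 / 24 * EisensteinSeries.E2 z + 1 / (8 * Real.pi * z.im)

/-- The correction term of `E2` under γ, a multiple of c/(cz + d), cancels against that of 1/Im z,
since |cz + d|² = (cz + d)(cz + d - 2ic Im z). -/
lemma eisStar_slash (γ : SL(2, ℤ)) : eisStar ∣[(2 : ℤ)] γ = eisStar := by
  ext z
  have h := congrFun (EisensteinSeries.E2_slash_action γ) z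
  rw [ModularForm.SL_slash_apply] at h ⊢
  simp only [Pi.sub_apply, Pi.smul_apply, smul_eq_mul, EisensteinSeries.D2] at h
  unfold eisStar
  rw [add_mul, mul_assoc, h, ModularGroup.im_smul_eq_div_normSq, riemannZeta_two]
  have hd : (UpperHalfPlane.denom γ z) ≠ 0 := UpperHalfPlane.denom_ne_zero _ _
  have hy : (z.im : ℂ) ≠ 0 := by exact_mod_cast z.im_pos.ne'
  have hn : ((Complex.normSq (UpperHalfPlane.denom γ z) : ℝ) : ℂ) =
      UpperHalfPlane.denom γ z * (UpperHalfPlane.denom γ z - 2 * I * γ 1 0 * z.im) := by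
    rw [← Complex.mul_conj, ModularGroup.denom_apply]
    congr 1
    apply Complex.ext <;> simp
    ring_nf
  have hn0 : UpperHalfPlane.denom γ z - 2 * I * γ 1 0 * z.im ≠ 0 := by
    intro h0
    rw [h0, mul_zero] at hn
    exact hd (by simp at hn)
  push_cast
  rw [hn]
  have hpi : (Real.pi : ℂ) ≠ 0 := by exact_mod_cast Real.pi_ne_zero
  generalize (UpperHalfPlane.denom γ z) = d at *
  generalize ((γ 1 0 : ℤ) : ℂ) = c at *
  generalize ((z.im : ℝ) : ℂ) = y at *
  generalize EisensteinSeries.E2 z = e at *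
  rw [_root_.zpow_neg, show (2 : ℤ) = ((2 : ℕ) : ℤ) from rfl, zpow_natCast]
  field_simp
  ring_nf

/-! ### Expansions with a 1/Im z term -/

/-- `g z - κ / Im z` has an expansion `∑ aₙ exp (2 π i n z / h)` with `a₀ = v`. -/
def HasExpansionOfWidth (h : ℕ) (g : ℍ → ℂ) (κ v : ℂ) : Prop :=
  ∃ a : ℕ → ℂ, a 0 = v ∧ ∀ z : ℍ,
    HasSum (fun n : ℕ => a n * cexp (2 * Real.pi * I * (n : ℂ) * (z : ℂ) / (h : ℂ)))
      (g z - κ / z.im)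

/-- `g z - κ / Im z` has an expansion in powers of `exp (2 π i z / h)` for some `h ≥ 1`, with
constant term `v`. -/
def HasExpansion (g : ℍ → ℂ) (κ v : ℂ) : Prop :=
  ∃ h : ℕ, 0 < h ∧ HasExpansionOfWidth h g κ v

/-- Stretching the index set of an expansion. -/
lemma hasSum_exp_stretch {k : ℕ} (hk : 0 < k) (a : ℕ → ℂ) (w v : ℂ)
    (hs : HasSum (fun n : ℕ => a n * cexp ((n : ℂ) * ((k : ℂ) * w))) v) :
    HasSum (fun n : ℕ => Function.extend (fun m : ℕ => k * m) a 0 n * cexp ((n : ℂ) * w)) v := by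
  have hinj : Function.Injective (fun m : ℕ => k * m) := fun x y hxy =>
    Nat.eq_of_mul_eq_mul_left hk hxy
  rw [← hasSum_extend_zero hinj] at hs
  refine hs.congr_fun ?_
  intro n
  by_cases hn : ∃ m, k * m = n
  · obtain ⟨m, rfl⟩ := hn
    rw [hinj.extend_apply a 0 m, hinj.extend_apply _ 0 m]
    push_cast
    ring_nf
  · rw [Function.extend_apply' _ _ _ hn, Function.extend_apply' _ _ _ hn]
    simp

lemma HasExpansionOfWidth.stretch {h : ℕ} {g : ℍ → ℂ} {κ v : ℂ} (H : HasExpansionOfWidth h g κ v)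
    {k : ℕ} (hk : 0 < k) : HasExpansionOfWidth (k * h) g κ v := by
  obtain ⟨a, ha, hs⟩ := H
  have hinj : Function.Injective (fun m : ℕ => k * m) := fun x y hxy =>
    Nat.eq_of_mul_eq_mul_left hk hxy
  refine ⟨Function.extend (fun m : ℕ => k * m) a 0, ?_, fun z => ?_⟩
  · rw [← ha]
    exact hinj.extend_apply a 0 0
  · have hk' : (k : ℂ) ≠ 0 := by exact_mod_cast hk.ne'
    have := hasSum_exp_stretch hk a (2 * Real.pi * I * (z : ℂ) / (k * h : ℕ)) _
      ((hs z).congr_fun fun n => ?_)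
    · refine this.congr_fun fun n => ?_
      ring_nf
    · congr 2
      push_cast
      field_simp

/-- Stretching brings both expansions to the common width h₁h₂; index 0 is fixed by stretching, so
constant terms add. -/
lemma HasExpansion.add {g₁ g₂ : ℍ → ℂ} {κ₁ κ₂ v₁ v₂ : ℂ} (H₁ : HasExpansion g₁ κ₁ v₁)
    (H₂ : HasExpansion g₂ κ₂ v₂) : HasExpansion (g₁ + g₂) (κ₁ + κ₂) (v₁ + v₂) := by
  obtain ⟨h₁, hp₁, H₁⟩ := H₁
  obtain ⟨h₂, hp₂, H₂⟩ := H₂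
  obtain ⟨a, ha, hs⟩ := H₁.stretch hp₂
  obtain ⟨b, hb, ht⟩ := H₂.stretch hp₁
  rw [mul_comm] at hs
  refine ⟨h₁ * h₂, Nat.mul_pos hp₁ hp₂, a + b, by simp [ha, hb], fun z => ?_⟩
  have := (hs z).add (ht z)
  rw [show (g₁ + g₂) z - (κ₁ + κ₂) / z.im = g₁ z - κ₁ / z.im + (g₂ z - κ₂ / z.im) by
    rw [Pi.add_apply]; ring]
  refine this.congr_fun fun n => ?_
  rw [Pi.add_apply]; ring

lemma HasExpansion.smul {g : ℍ → ℂ} {κ v : ℂ} (H : HasExpansion g κ v) (c : ℂ) :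
    HasExpansion (c • g) (c * κ) (c * v) := by
  obtain ⟨h, hp, a, ha, hs⟩ := H
  refine ⟨h, hp, c • a, by simp [ha], fun z => ?_⟩
  have := (hs z).mul_left c
  rw [show (c • g) z - c * κ / z.im = c * (g z - κ / z.im) by
    rw [Pi.smul_apply, smul_eq_mul]; ring]
  refine this.congr_fun fun n => ?_
  rw [Pi.smul_apply, smul_eq_mul]; ring

lemma HasExpansion.zero : HasExpansion 0 0 0 :=
  ⟨1, one_pos, 0, rfl, fun z => by simp⟩

lemma HasExpansion.sum {ι : Type*} (s : Finset ι) {g : ι → ℍ → ℂ} {κ v : ι → ℂ}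
    (H : ∀ i ∈ s, HasExpansion (g i) (κ i) (v i)) :
    HasExpansion (∑ i ∈ s, g i) (∑ i ∈ s, κ i) (∑ i ∈ s, v i) := by
  classical
  induction s using Finset.induction_on with
  | empty => simpa using HasExpansion.zero
  | insert i s hi ih =>
    rw [Finset.sum_insert hi, Finset.sum_insert hi, Finset.sum_insert hi]
    exact (H i (Finset.mem_insert_self _ _)).add
      (ih fun j hj => H j (Finset.mem_insert_of_mem hj))

/-! ### Constant terms of translates by integral matrices -/

lemma slash_apply_of_upper (F : ℍ → ℂ) (g : GL (Fin 2) ℝ) {A B D : ℝ} (hA : 0 < A) (hD : 0 < D)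
    (hg : (g : Matrix (Fin 2) (Fin 2) ℝ) = !![A, B; 0, D]) (z : ℍ) :
    (F ∣[(2 : ℤ)] g) z = A / D * F (g • z) ∧
      ((g • z : ℍ) : ℂ) = (A * z + B) / D ∧ (g • z).im = A * z.im / D := by
  have h00 : g 0 0 = A := by simp [hg]
  have h01 : g 0 1 = B := by simp [hg]
  have h10 : g 1 0 = 0 := by simp [hg]
  have h11 : g 1 1 = D := by simp [hg]
  have hdet : (GeneralLinearGroup.det g).val = A * D := by
    rw [GeneralLinearGroup.val_det_apply, Matrix.det_fin_two, h00, h01, h10, h11]; ring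
  have hpos : 0 < (GeneralLinearGroup.det g).val := by rw [hdet]; positivity
  have hden : UpperHalfPlane.denom g z = D := by
    simp [UpperHalfPlane.denom, h10, h11]
  have hc : ((g • z : ℍ) : ℂ) = (A * z + B) / D := by
    rw [UpperHalfPlane.coe_smul_of_det_pos hpos, hden, UpperHalfPlane.num, h00, h01]
  have hD' : (D : ℂ) ≠ 0 := by exact_mod_cast hD.ne'
  refine ⟨?_, hc, ?_⟩
  · rw [ModularForm.slash_apply, hden, hdet, UpperHalfPlane.σ, if_pos hpos,
      abs_of_pos (by positivity : 0 < A * D), _root_.zpow_neg,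
      show (2 : ℤ) - 1 = 1 by norm_num, show (2 : ℤ) = ((2 : ℕ) : ℤ) from rfl, zpow_natCast]
    simp
    field_simp
  · rw [UpperHalfPlane.im_smul_eq_div_normSq, hden, hdet, abs_of_pos (by positivity : 0 < A * D),
      Complex.normSq_ofReal]
    field_simp

/-- The factor A/D of the slash action cancels the scaling of Im z, so the coefficient of 1/Im z
never changes. The q-expansion at (Az + b)/D is a series in exp(2πiAz/D), hence one of width D
supported on multiples of A. -/
lemma hasExpansion_eisStar_upper (A D : ℕ) (hA : 0 < A) (hD : 0 < D)
    (g : GL (Fin 2) ℝ) {b : ℝ}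
    (hg : (g : Matrix (Fin 2) (Fin 2) ℝ) = !![(A : ℝ), b; 0, D]) :
    HasExpansion (eisStar ∣[(2 : ℤ)] g) (1 / (8 * Real.pi)) (-1 / 24 * ((A : ℂ) / D)) := by
  have hA' : (0 : ℝ) < A := by exact_mod_cast hA
  have hD' : (0 : ℝ) < D := by exact_mod_cast hD
  have hA0 : (A : ℂ) ≠ 0 := by exact_mod_cast hA.ne'
  have hD0 : (D : ℂ) ≠ 0 := by exact_mod_cast hD.ne'
  have hinj : Function.Injective (fun m : ℕ => A * m) := fun x y hxy =>
    Nat.eq_of_mul_eq_mul_left hA hxy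
  set a : ℕ → ℂ := fun n => -1 / 24 * ((A : ℂ) / D) *
    ((if n = 0 then 1 else -24 * (ArithmeticFunction.sigma 1 n : ℂ)) *
      cexp (2 * Real.pi * I * n * (b / D))) with ha
  refine ⟨D, hD, Function.extend (fun m : ℕ => A * m) a 0, ?_, fun z => ?_⟩
  · have := hinj.extend_apply a 0 0
    simp only [mul_zero] at this
    rw [this]; simp [ha]
  · obtain ⟨h1, h2, h3⟩ := slash_apply_of_upper eisStar g hA' hD' hg z
    have hE := (EisensteinSeries.hasSum_qExpansion_E2 (g • z)).mul_left (-1 / 24 * ((A : ℂ) / D))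
    have hy : (z.im : ℂ) ≠ 0 := by exact_mod_cast z.im_pos.ne'
    have hpi : (Real.pi : ℂ) ≠ 0 := by exact_mod_cast Real.pi_ne_zero
    have hval : (eisStar ∣[(2 : ℤ)] g) z - 1 / (8 * Real.pi) / z.im =
        -1 / 24 * ((A : ℂ) / D) * EisensteinSeries.E2 (g • z) := by
      rw [h1, eisStar, h3]
      push_cast
      field_simp
      ring
    rw [hval]
    have := hasSum_exp_stretch hA a (2 * Real.pi * I * (z : ℂ) / D) _ (hE.congr_fun fun n => ?_)
    · refine this.congr_fun fun n => ?_
      ring_nf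
    · rw [h2, ← Complex.exp_nat_mul, ha, smul_eq_mul]
      simp only [mul_assoc]
      congr 3
      rw [← Complex.exp_add]
      congr 1
      push_cast
      field_simp
      ring

lemma coe_mapGL_real (γ : SL(2, ℤ)) : ((mapGL ℝ γ : GL (Fin 2) ℝ) : Matrix (Fin 2) (Fin 2) ℝ) =
    (γ : Matrix (Fin 2) (Fin 2) ℤ).map (fun n : ℤ => (n : ℝ)) := rfl

/-- The expansion of the slash translates of the Eisenstein series of level one by integral
matrices. -/
lemma hasExpansion_eisStar_slash (g : GL (Fin 2) ℝ) (A : Matrix (Fin 2) (Fin 2) ℤ)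
    (hg : (g : Matrix (Fin 2) (Fin 2) ℝ) = A.map (fun n : ℤ => (n : ℝ))) (hA : 0 < A.det) :
    HasExpansion (eisStar ∣[(2 : ℤ)] g) (1 / (8 * Real.pi))
      (-1 / 24 * ((Int.gcd (A 0 0) (A 1 0) : ℂ) ^ 2 / A.det)) := by
  rw [Matrix.det_fin_two] at hA
  set G := Int.gcd (A 0 0) (A 1 0) with hG
  have hGpos : 0 < G := by
    rw [hG, Int.gcd_pos_iff]
    by_contra! h
    rw [h.1, h.2] at hA; simp at hA
  obtain ⟨a, ha⟩ := Int.gcd_dvd_left (A 0 0) (A 1 0)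
  obtain ⟨c, hc⟩ := Int.gcd_dvd_right (A 0 0) (A 1 0)
  rw [← hG] at ha hc
  have hbez := Int.gcd_eq_gcd_ab (A 0 0) (A 1 0)
  set x := Int.gcdA (A 0 0) (A 1 0)
  set y := Int.gcdB (A 0 0) (A 1 0)
  rw [← hG] at hbez
  have hGZ : (0 : ℤ) < G := by exact_mod_cast hGpos
  have hone : x * a + y * c = 1 := by
    apply mul_left_cancel₀ hGZ.ne'
    rw [ha, hc] at hbez
    linear_combination -hbez
  have hdet : A.det = G * (a * A 1 1 - c * A 0 1) := by
    rw [Matrix.det_fin_two, ha, hc]; ring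
  have hDpos : 0 < a * A 1 1 - c * A 0 1 := by
    rw [Matrix.det_fin_two] at hdet
    rw [hdet] at hA
    exact (mul_pos_iff_of_pos_left hGZ).mp hA
  obtain ⟨D, hD⟩ : ∃ D : ℕ, (D : ℤ) = a * A 1 1 - c * A 0 1 :=
    ⟨_, Int.toNat_of_nonneg hDpos.le⟩
  -- Bézout row reduction: left multiplication by this γ makes the matrix upper triangular with
  -- diagonal (G, det/G), so the ratio of its diagonal entries is G²/det.
  let γ : SL(2, ℤ) := ⟨!![x, y; -c, a], by rw [Matrix.det_fin_two_of]; linarith⟩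
  have hmat : ((mapGL ℝ γ * g : GL (Fin 2) ℝ) : Matrix (Fin 2) (Fin 2) ℝ) =
      !![(G : ℝ), ((x * A 0 1 + y * A 1 1 : ℤ) : ℝ); 0, D] := by
    have hval : (mapGL ℝ γ : Matrix (Fin 2) (Fin 2) ℝ) =
        !![(x : ℝ), y; -c, a] := by
      rw [coe_mapGL_real]
      ext i j
      fin_cases i <;> fin_cases j <;> simp [γ]
    have hA' : A.map (fun n : ℤ => (n : ℝ)) = !![(A 0 0 : ℝ), A 0 1; A 1 0, A 1 1] := by
      ext i j
      fin_cases i <;> fin_cases j <;> simp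
    have e1 : ((x * A 0 0 + y * A 1 0 : ℤ) : ℝ) = G := by
      have : x * A 0 0 + y * A 1 0 = G := by linarith
      exact_mod_cast this
    have e2 : ((-c * A 0 0 + a * A 1 0 : ℤ) : ℝ) = 0 := by
      have : -c * A 0 0 + a * A 1 0 = 0 := by rw [ha, hc]; ring
      exact_mod_cast this
    have e3 : ((-c * A 0 1 + a * A 1 1 : ℤ) : ℝ) = D := by
      have : -c * A 0 1 + a * A 1 1 = D := by linarith
      exact_mod_cast this
    rw [GeneralLinearGroup.coe_mul, hval, hg, hA', Matrix.mul_fin_two]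
    push_cast at e1 e2 e3 ⊢
    rw [e1, e2, e3]
  have hslash : eisStar ∣[(2 : ℤ)] g = eisStar ∣[(2 : ℤ)] (mapGL ℝ γ * g : GL (Fin 2) ℝ) := by
    rw [SlashAction.slash_mul]
    exact congrArg (· ∣[(2 : ℤ)] g) (eisStar_slash γ).symm
  rw [hslash]
  have hDN : 0 < D := by exact_mod_cast hD ▸ hDpos
  convert hasExpansion_eisStar_upper G D hGpos hDN _ hmat using 2
  have hdC : (A.det : ℂ) = G * D := by
    rw [hdet, ← hD]; push_cast; rfl
  have : (G : ℂ) ≠ 0 := by exact_mod_cast hGpos.ne'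
  rw [hdC]
  field_simp

/-! ### Diagonal and translation matrices -/

/-- The matrix `diag(d, 1)`. -/
noncomputable def diagGL (d : ℕ) (hd : (d : ℝ) ≠ 0) : GL (Fin 2) ℝ :=
  Matrix.GeneralLinearGroup.mkOfDetNeZero !![(d : ℝ), 0; 0, 1]
    (by simpa [Matrix.det_fin_two] using hd)

lemma diagGL_mul {m n : ℕ} (hm : (m : ℝ) ≠ 0) (hn : (n : ℝ) ≠ 0) (h : ((m * n : ℕ) : ℝ) ≠ 0) :
    diagGL m hm * diagGL n hn = diagGL (m * n) h := by
  apply Units.ext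
  rw [GeneralLinearGroup.coe_mul]
  change !![(m : ℝ), 0; 0, 1] * !![(n : ℝ), 0; 0, 1] = !![((m * n : ℕ) : ℝ), 0; 0, 1]
  rw [Matrix.mul_fin_two]
  simp

lemma gammaOp_eq {p : ℕ} (hp : (p : ℝ) ≠ 0) (g : ℍ → ℂ) :
    gammaOp p g = g ∣[(2 : ℤ)] diagGL p hp := by
  unfold gammaOp
  rw [dif_pos hp]
  rfl

/-- Scalars would be conjugated by a matrix of negative determinant; here the determinant is
positive. -/
lemma smul_slash_diagGL_mul (c : ℂ) (d : ℕ) (hd : (d : ℝ) ≠ 0) (γ : SL(2, ℤ)) (g : ℍ → ℂ) :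
    (c • g) ∣[(2 : ℤ)] (diagGL d hd * mapGL ℝ γ) =
      c • (g ∣[(2 : ℤ)] (diagGL d hd * mapGL ℝ γ)) := by
  have hpos : 0 < (GeneralLinearGroup.det (diagGL d hd)).val := by
    rw [GeneralLinearGroup.val_det_apply]
    change 0 < (!![(d : ℝ), 0; 0, 1]).det
    rw [Matrix.det_fin_two_of]
    have : (0 : ℝ) < d := lt_of_le_of_ne (Nat.cast_nonneg d) hd.symm
    simpa
  rw [SlashAction.slash_mul, ModularForm.smul_slash, UpperHalfPlane.σ, if_pos hpos,
    SlashAction.slash_mul]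
  exact ModularForm.SL_smul_slash 2 γ _ c

/-- The translation matrix `(f u; 0 f)`. -/
noncomputable def transGL (f u : ℕ) (hf : (f : ℝ) ≠ 0) : GL (Fin 2) ℝ :=
  Matrix.GeneralLinearGroup.mkOfDetNeZero !![(f : ℝ), u; 0, f]
    (by simpa [Matrix.det_fin_two] using hf)

lemma eisStar_slash_transGL (f u : ℕ) (hf : (f : ℝ) ≠ 0) (z : ℍ) :
    ∃ w : ℍ, (w : ℂ) = z + u / f ∧ (eisStar ∣[(2 : ℤ)] transGL f u hf) z =
      -1 / 24 * EisensteinSeries.E2 w + 1 / (8 * Real.pi * z.im) := by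
  have hf' : (0 : ℝ) < f := lt_of_le_of_ne (Nat.cast_nonneg f) hf.symm
  obtain ⟨h1, h2, h3⟩ := slash_apply_of_upper eisStar (transGL f u hf) (B := u) hf' hf' rfl z
  have hfC : (f : ℂ) ≠ 0 := by exact_mod_cast hf
  refine ⟨transGL f u hf • z, ?_, ?_⟩
  · rw [h2]
    push_cast
    field_simp
  · rw [h1, eisStar, h3, mul_div_cancel_left₀ _ hf'.ne']
    push_cast
    rw [div_self hfC, one_mul]

/-- The expansion of `E | (f u; 0 f) diag(d, 1) γ` for the Eisenstein series `E` of level one. -/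
lemma hasExpansion_eisStar_trans_diag (f u d : ℕ) (hf : (f : ℝ) ≠ 0) (hd : (d : ℝ) ≠ 0)
    (γ : SL(2, ℤ)) :
    HasExpansion ((eisStar ∣[(2 : ℤ)] transGL f u hf) ∣[(2 : ℤ)] (diagGL d hd * mapGL ℝ γ))
      (1 / (8 * Real.pi))
      (-1 / 24 * ((Int.gcd (f * (d * γ 0 0) + u * γ 1 0) (f * γ 1 0) : ℂ) ^ 2 /
        ((f : ℂ) ^ 2 * d))) := by
  rw [← SlashAction.slash_mul]
  set a := γ 0 0
  set b := γ 0 1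
  set c := γ 1 0
  set e := γ 1 1
  have hdetγ : a * e - b * c = 1 := by
    have := γ.det_coe
    rwa [Matrix.det_fin_two] at this
  set A : Matrix (Fin 2) (Fin 2) ℤ :=
    !![(f : ℤ) * (d * a) + u * c, f * (d * b) + u * e; f * c, f * e] with hA
  have hdet : A.det = (f : ℤ) ^ 2 * d := by
    rw [hA, Matrix.det_fin_two_of]
    linear_combination ((f : ℤ) ^ 2 * d) * hdetγ
  have hpos : 0 < A.det := by
    rw [hdet]
    have h1 : 0 < f := Nat.pos_of_ne_zero (by exact_mod_cast hf)
    have h2 : 0 < d := Nat.pos_of_ne_zero (by exact_mod_cast hd)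
    positivity
  have := hasExpansion_eisStar_slash (transGL f u hf * (diagGL d hd * mapGL ℝ γ)) A ?_ hpos
  · rw [hdet] at this
    push_cast at this
    exact this
  · rw [GeneralLinearGroup.coe_mul, GeneralLinearGroup.coe_mul, coe_mapGL_real]
    have hγ : (γ : Matrix (Fin 2) (Fin 2) ℤ).map (fun n : ℤ => (n : ℝ)) =
        !![(a : ℝ), b; c, e] := by
      ext i j
      fin_cases i <;> fin_cases j <;> rfl
    rw [hγ]
    change !![(f : ℝ), u; 0, f] * (!![(d : ℝ), 0; 0, 1] * _) = _
    rw [Matrix.mul_fin_two, Matrix.mul_fin_two]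
    ext i j
    fin_cases i <;> fin_cases j <;> simp [hA]

/-! ### Exponential sums of primitive quadratic characters -/

lemma sum_range_eq_sum_zmod {f : ℕ} [NeZero f] {R : Type*} [AddCommMonoid R] (F : ZMod f → R) :
    ∑ u ∈ Finset.range f, F (u : ZMod f) = ∑ z : ZMod f, F z := by
  refine Finset.sum_bij' (fun u _ => (u : ZMod f)) (fun z _ => z.val) ?_ ?_ ?_ ?_ ?_
  · simp
  · intro z _
    exact Finset.mem_range.mpr (ZMod.val_lt z)
  · intro u hu
    exact ZMod.val_cast_of_lt (Finset.mem_range.mp hu)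
  · intro z _
    exact ZMod.natCast_zmod_val z
  · intros; rfl

lemma sum_range_mul {R : Type*} [AddCommMonoid R] (F : ℕ → R) (f k : ℕ) :
    ∑ b ∈ Finset.range (f * k), F b =
      ∑ j ∈ Finset.range k, ∑ b ∈ Finset.range f, F (f * j + b) := by
  induction k with
  | zero => simp
  | succ k ih => rw [Nat.mul_succ, Finset.sum_range_add, ih, Finset.sum_range_succ]

section characters

variable {f : ℕ} {χ : DirichletCharacter ℂ f}

lemma char_mul_self_eq_one (hq : χ.IsQuadratic) {a : ZMod f} (ha : IsUnit a) : χ a * χ a = 1 := by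
  have h0 : χ a ≠ 0 := (ha.map χ).ne_zero
  rcases hq a with h | h | h
  · exact absurd h h0
  · rw [h]; norm_num
  · rw [h]; norm_num

lemma char_eq_zero_of_not_coprime {n : ℕ} (hn : ¬ n.Coprime f) : χ (n : ZMod f) = 0 :=
  χ.map_nonunit fun h => hn ((ZMod.isUnit_iff_coprime n f).mp h)

variable [NeZero f]

lemma sum_char_mul_exp (hχ : χ.IsPrimitive) (hq : χ.IsQuadratic) (n : ℤ) :
    ∑ u ∈ Finset.range f, χ (u : ZMod f) * cexp (2 * Real.pi * I * (n * u) / f) =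
      χ (n : ZMod f) * gauss χ := by
  have h := gaussSum_mulShift_of_isPrimitive (ZMod.stdAddChar (N := f)) hχ (n : ZMod f)
  rw [hq.inv] at h
  rw [gauss, ← h, gaussSum, ← sum_range_eq_sum_zmod]
  refine Finset.sum_congr rfl fun u _ => ?_
  congr 1
  rw [AddChar.mulShift_apply]
  have := ZMod.stdAddChar_coe (N := f) (n * u)
  push_cast at this
  rw [this]

/-- Splitting b = fj + b' makes the sum over j geometric: it is f or 0 according to whether f
divides n. In the first case a Gauss sum modulo f at n/f remains. -/
lemma char_sum_sq_level (hχ : χ.IsPrimitive) (hq : χ.IsQuadratic) (n : ℤ) :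
    ∑ b ∈ Finset.range (f ^ 2), χ (b : ZMod f) * cexp (2 * Real.pi * I * (n * b) / (f : ℂ) ^ 2) =
      if (f : ℤ) ∣ n then f * (χ ((n / f : ℤ) : ZMod f) * gauss χ) else 0 := by
  have hf0 : (f : ℂ) ≠ 0 := NeZero.ne _
  rw [pow_two, sum_range_mul]
  have hterm : ∀ j b : ℕ, χ ((f * j + b : ℕ) : ZMod f) *
      cexp (2 * Real.pi * I * (n * (f * j + b : ℕ)) / (f : ℂ) ^ 2) =
      cexp (2 * Real.pi * I * (n / f)) ^ j *
        (χ (b : ZMod f) * cexp (2 * Real.pi * I * (n * b) / (f : ℂ) ^ 2)) := by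
    intro j b
    rw [← Complex.exp_nat_mul, mul_left_comm (cexp _), ← Complex.exp_add]
    congr 2
    · push_cast; rw [ZMod.natCast_self]; ring
    · push_cast; field_simp
  simp_rw [hterm, ← Finset.mul_sum, ← Finset.sum_mul]
  split_ifs with hd
  · obtain ⟨k, rfl⟩ := hd
    have h1 : cexp (2 * Real.pi * I * (((f : ℤ) * k : ℤ) / f : ℂ)) = 1 := by
      rw [Complex.exp_eq_one_iff]
      refine ⟨k, ?_⟩
      push_cast; field_simp
    rw [h1]
    have hfz : (f : ℤ) ≠ 0 := by exact_mod_cast NeZero.ne f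
    rw [Int.mul_ediv_cancel_left _ hfz, ← sum_char_mul_exp hχ hq]
    simp only [one_pow, Finset.sum_const, Finset.card_range, nsmul_eq_mul, mul_one]
    congr 1
    refine Finset.sum_congr rfl fun b _ => ?_
    congr 2
    push_cast; field_simp
  · have h1 : cexp (2 * Real.pi * I * (n / f)) ≠ 1 := by
      intro h
      rw [Complex.exp_eq_one_iff] at h
      obtain ⟨k, hk⟩ := h
      apply hd
      refine ⟨k, ?_⟩
      have hpi : (2 * Real.pi * I : ℂ) ≠ 0 := Complex.two_pi_I_ne_zero
      have : (n / f : ℂ) = k := mul_left_cancel₀ hpi (by rw [hk]; ring)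
      field_simp at this
      exact_mod_cast this
    rw [geom_sum_eq h1, ← Complex.exp_nat_mul]
    have h2 : cexp (f * (2 * Real.pi * I * (n / f))) = 1 := by
      rw [Complex.exp_eq_one_iff]
      refine ⟨n, ?_⟩
      field_simp
    rw [h2]; simp

lemma sum_char_indicator (ε : ℤ) (hε : ε * ε = 1) (j : ℤ) :
    ∑ a ∈ Finset.range f, χ (a : ZMod f) *
      (if (j : ZMod f) = ((ε * a : ℤ) : ZMod f) then 1 else 0) = χ ((ε * j : ℤ) : ZMod f) := by
  have hε' : ((ε : ZMod f)) * ε = 1 := by exact_mod_cast congrArg (Int.cast : ℤ → ZMod f) hε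
  have key : ∀ a : ℕ, χ (a : ZMod f) *
      (if (j : ZMod f) = ((ε * a : ℤ) : ZMod f) then 1 else 0) =
      if (a : ZMod f) = ((ε * j : ℤ) : ZMod f) then χ (a : ZMod f) else 0 := by
    intro a
    have : (j : ZMod f) = ((ε * a : ℤ) : ZMod f) ↔ (a : ZMod f) = ((ε * j : ℤ) : ZMod f) := by
      push_cast
      constructor
      · intro h; rw [h, ← mul_assoc, hε', one_mul]
      · intro h; rw [h, ← mul_assoc, hε', one_mul]
    by_cases h : (a : ZMod f) = ((ε * j : ℤ) : ZMod f)
    · rw [if_pos h, if_pos (this.mpr h), mul_one]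
    · rw [if_neg h, if_neg (fun h' => h (this.mp h')), mul_zero]
  simp_rw [key]
  rw [sum_range_eq_sum_zmod (fun a => if a = ((ε * j : ℤ) : ZMod f) then χ a else 0)]
  simp

end characters

/-! ### Hecke's functions as a twist of level one -/

/-- The index bijection for the outer sum in `P`. -/
noncomputable def posRatEquiv (f : ℕ) [NeZero f] (a : ℤ) :
    {j : ℕ+ // ((j : ℕ) : ZMod f) = (a : ZMod f)} ≃
      {k : ℚ // 0 < k ∧ ∃ n : ℤ, k = (a : ℚ) / f + n} :=
  Equiv.ofBijective (fun j => ⟨((j : ℕ+) : ℕ) / f, by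
      have hf0 : (0 : ℚ) < f := by exact_mod_cast Nat.pos_of_ne_zero (NeZero.ne f)
      obtain ⟨j, hj⟩ := j
      refine ⟨div_pos (by exact_mod_cast j.pos) hf0, ?_⟩
      have hj' : ((((j : ℕ) : ℤ) : ZMod f)) = ((a : ℤ) : ZMod f) := by simpa using hj
      rw [ZMod.intCast_eq_intCast_iff_dvd_sub] at hj'
      obtain ⟨n, hn⟩ := hj'
      refine ⟨-n, ?_⟩
      have : ((j : ℕ) : ℚ) = a - f * n := by
        have : ((j : ℕ) : ℤ) = a - f * n := by linarith
        exact_mod_cast this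
      rw [this]; push_cast; field_simp; ring⟩)
    ⟨by
      have hf0 : (f : ℚ) ≠ 0 := NeZero.ne _
      rintro ⟨i, hi⟩ ⟨j, hj⟩ h
      have h' : ((i : ℕ) : ℚ) / f = ((j : ℕ) : ℚ) / f := congrArg Subtype.val h
      rw [div_left_inj' hf0] at h'
      exact Subtype.ext (PNat.eq (by exact_mod_cast h')), by
      have hf0 : (0 : ℚ) < f := by exact_mod_cast Nat.pos_of_ne_zero (NeZero.ne f)
      rintro ⟨k, hk, n, hn⟩
      have hk' : k * f = ((a + n * f : ℤ) : ℚ) := by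
        rw [hn]; push_cast; field_simp
      have hpos : 0 < a + n * f := by
        have : (0 : ℚ) < ((a + n * f : ℤ) : ℚ) := by rw [← hk']; positivity
        exact_mod_cast this
      obtain ⟨m, hm⟩ : ∃ m : ℕ, (m : ℤ) = a + n * f := ⟨_, Int.toNat_of_nonneg hpos.le⟩
      have hm0 : 0 < m := by exact_mod_cast hm ▸ hpos
      refine ⟨⟨⟨m, hm0⟩, ?_⟩, ?_⟩
      · have := congrArg (Int.cast : ℤ → ZMod f) hm
        simpa using this
      · apply Subtype.ext
        change ((m : ℕ) : ℚ) / f = k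
        rw [← hm] at hk'
        rw [div_eq_iff hf0.ne', hk']
        norm_cast⟩

lemma hasSum_P (f : ℕ) [NeZero f] (a b : ℤ) (z : ℍ) :
    HasSum (fun p : ℕ+ × ℕ+ => (if ((p.1 : ℕ) : ZMod f) = (a : ZMod f) then (1 : ℂ) else 0) *
        ((p.1 / f : ℂ) * cexp (2 * Real.pi * I * ((p.2 : ℂ) * p.1 * z / f)) *
          cexp (2 * Real.pi * I * (p.2 * b) / (f : ℂ) ^ 2)))
      (P ((a : ℚ) / f) ((b : ℚ) / (f : ℚ) ^ 2) z) := by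
  have hf0 : (f : ℂ) ≠ 0 := NeZero.ne _
  have hfp : (0 : ℝ) < f := by exact_mod_cast Nat.pos_of_ne_zero (NeZero.ne f)
  set F : ℕ+ × ℕ+ → ℂ := fun p => (if ((p.1 : ℕ) : ZMod f) = (a : ZMod f) then (1 : ℂ) else 0) *
        ((p.1 / f : ℂ) * cexp (2 * Real.pi * I * ((p.2 : ℂ) * p.1 * z / f)) *
          cexp (2 * Real.pi * I * (p.2 * b) / (f : ℂ) ^ 2)) with hF
  have hr : ‖cexp (2 * Real.pi * I * (z / f))‖ < 1 := by
    rw [Complex.norm_exp, Real.exp_lt_one_iff]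
    have : (2 * Real.pi * I * (z / f) : ℂ).re = -(2 * Real.pi * z.im / f) := by
      rw [show (2 * Real.pi * I * (z / f) : ℂ) = ((2 * Real.pi / f : ℝ) : ℂ) * (I * z) by
        push_cast; ring, Complex.re_ofReal_mul]
      simp; ring
    rw [this, neg_lt_zero]
    have := z.im_pos
    have := Real.pi_pos
    positivity
  have hsum : Summable F := by
    -- Domination by f⁻¹ ∑ j |q|^{jm} with q = exp(2πiz/f): the indicator is at most 1 in norm and
    -- the phase has norm 1.
    have h0 := (summable_prod_mul_pow 1 hr).prod_symm.norm.mul_left (1 / (f : ℝ))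
    refine Summable.of_norm_bounded h0 fun p => ?_
    have hb : ‖cexp (2 * Real.pi * I * (p.2 * b) / (f : ℂ) ^ 2)‖ = 1 := by
      rw [show (2 * Real.pi * I * (p.2 * b) / (f : ℂ) ^ 2 : ℂ) =
        ((2 * Real.pi * (p.2 * b) / (f : ℝ) ^ 2 : ℝ) : ℂ) * I by push_cast; ring]
      exact Complex.norm_exp_ofReal_mul_I _
    have he : cexp (2 * Real.pi * I * ((p.2 : ℂ) * p.1 * z / f)) =
        cexp (2 * Real.pi * I * (z / f)) ^ ((p.2 : ℕ) * p.1) := by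
      rw [← Complex.exp_nat_mul]; congr 1; push_cast; ring
    rw [hF]
    simp only [norm_mul, hb, he, mul_one, Prod.swap, pow_one]
    have h1 : ‖(if ((p.1 : ℕ) : ZMod f) = (a : ZMod f) then (1 : ℂ) else 0)‖ ≤ 1 := by
      split_ifs <;> simp
    rw [norm_div, Complex.norm_natCast]
    refine (mul_le_of_le_one_left (by positivity) h1).trans (le_of_eq ?_)
    rw [norm_natCast]
    ring
  have htsum : P ((a : ℚ) / f) ((b : ℚ) / (f : ℚ) ^ 2) z = ∑' p, F p := by
    rw [hsum.tsum_prod, P, ← (posRatEquiv f a).tsum_eq]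
    have hind : ∀ j : ℕ+, ∑' m, F (j, m) =
        Set.indicator {j : ℕ+ | ((j : ℕ) : ZMod f) = (a : ZMod f)} (fun j : ℕ+ =>
          ((((j : ℕ) : ℚ) / f : ℚ) : ℂ) * ∑' m : ℕ+, cexp (2 * Real.pi * I * (m : ℂ) *
            (((((j : ℕ) : ℚ) / f : ℚ) : ℂ) * z + (((b : ℚ) / (f : ℚ) ^ 2 : ℚ) : ℂ)))) j := by
      intro j
      by_cases hj : ((j : ℕ) : ZMod f) = (a : ZMod f)
      · rw [Set.indicator_of_mem (show j ∈ {j : ℕ+ | ((j : ℕ) : ZMod f) = (a : ZMod f)} from hj), ← tsum_mul_left]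
        refine tsum_congr fun m => ?_
        simp only [hF]
        rw [if_pos hj, one_mul, mul_assoc, ← Complex.exp_add]
        push_cast
        congr 2
        field_simp
      · rw [Set.indicator_of_notMem (show j ∉ {j : ℕ+ | ((j : ℕ) : ZMod f) = (a : ZMod f)} from hj)]
        simp only [hF]
        simp [if_neg hj]
    simp_rw [hind]
    rw [← tsum_subtype]
    rfl
  rw [htsum]
  exact hsum.hasSum

/-- The double Lambert series `∑ j exp (2 π i j m z)` behind the Eisenstein series of weight two. -/
lemma hasSum_E2 (z : ℍ) :
    ∃ S : ℂ, HasSum (fun p : ℕ+ × ℕ+ => (p.1 : ℂ) * cexp (2 * Real.pi * I * ((p.1 : ℂ) * p.2 * z))) S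
      ∧ EisensteinSeries.E2 z = 1 - 24 * S := by
  have hr := UpperHalfPlane.norm_exp_two_pi_I_lt_one z
  have hs := (summable_prod_mul_pow 1 hr).prod_symm
  have he : ∀ p : ℕ+ × ℕ+, (p.1 : ℂ) * cexp (2 * Real.pi * I * ((p.1 : ℂ) * p.2 * z)) =
      (fun p : ℕ+ × ℕ+ => ((p.2 : ℕ) : ℂ) ^ 1 * cexp (2 * Real.pi * I * z) ^ ((p.1 : ℕ) * p.2)) p.swap := by
    intro p
    simp only [Prod.fst_swap, Prod.snd_swap, pow_one]
    rw [← Complex.exp_nat_mul]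
    congr 2
    push_cast; ring
  refine ⟨_, hs.hasSum.congr_fun he, ?_⟩
  rw [EisensteinSeries.E2_eq_tsum_cexp, ← tsum_prod_pow_eq_tsum_sigma 1 hr,
    ← (summable_prod_mul_pow 1 hr).tsum_prod]
  congr 2
  exact ((Equiv.prodComm ℕ+ ℕ+).tsum_eq _).symm

section characters

variable {f : ℕ} [NeZero f] {χ : DirichletCharacter ℂ f}

/-- Translating z by u/f multiplies the (j, m) term by exp(2πijmu/f); the sum over u against χ is
then a Gauss sum at jm. -/
lemma hasSum_twist (hχ : χ.IsPrimitive) (hq : χ.IsQuadratic) (z : ℍ) (S : ℕ → ℂ)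
    (hS : ∀ u : ℕ, HasSum (fun p : ℕ+ × ℕ+ =>
      (p.1 : ℂ) * cexp (2 * Real.pi * I * ((p.1 : ℂ) * p.2 * (z + u / f)))) (S u)) :
    HasSum (fun p : ℕ+ × ℕ+ => gauss χ * (χ ((p.1 * p.2 : ℕ) : ZMod f) *
      ((p.1 : ℂ) * cexp (2 * Real.pi * I * ((p.1 : ℂ) * p.2 * z)))))
      (∑ u ∈ Finset.range f, χ (u : ZMod f) * S u) := by
  refine (hasSum_sum (s := Finset.range f)
    fun u _ => (hS u).mul_left (χ (u : ZMod f))).congr_fun fun p => ?_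
  have h := sum_char_mul_exp hχ hq ((p.1 * p.2 : ℕ) : ℤ)
  rw [Int.cast_natCast (R := ZMod f)] at h
  rw [← mul_assoc, mul_comm (gauss χ), ← h, Finset.sum_mul]
  refine Finset.sum_congr rfl fun u _ => ?_
  have : cexp (2 * Real.pi * I * ((p.1 : ℂ) * p.2 * (z + u / f))) =
      cexp (2 * Real.pi * I * ((((p.1 * p.2 : ℕ) : ℤ) : ℂ) * u) / f) *
        cexp (2 * Real.pi * I * ((p.1 : ℂ) * p.2 * z)) := by
    rw [← Complex.exp_add]; congr 1; push_cast; ring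
  rw [this]; ring

/-- The sum over a selects χ(j). The sum over b kills every m not divisible by f and gives f χ(m/f)
g(χ) on the others, so putting m = fm' produces the series of `hasSum_twist`. The sign ε treats P_x
and P_{-x} together: it enters twice and χ(ε)² = 1. -/
lemma hasSum_char_P (hχ : χ.IsPrimitive) (hq : χ.IsQuadratic) (z : ℍ) (ε : ℤ) (hε : ε * ε = 1) :
    HasSum (fun p : ℕ+ × ℕ+ => gauss χ * (χ ((p.1 * p.2 : ℕ) : ZMod f) *
      ((p.1 : ℂ) * cexp (2 * Real.pi * I * ((p.1 : ℂ) * p.2 * z)))))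
      (∑ a ∈ Finset.range f, ∑ b ∈ Finset.range (f ^ 2), χ (a : ZMod f) * χ (b : ZMod f) *
        P (((ε * a : ℤ) : ℚ) / f) (((ε * b : ℤ) : ℚ) / (f : ℚ) ^ 2) z) := by
  have hf0 : (f : ℂ) ≠ 0 := NeZero.ne _
  have hfz : (f : ℤ) ≠ 0 := by exact_mod_cast NeZero.ne f
  have hfpos : 0 < f := Nat.pos_of_ne_zero (NeZero.ne f)
  obtain ⟨F, hF⟩ : ∃ F : ℕ+, (F : ℕ) = f := ⟨⟨f, hfpos⟩, rfl⟩
  have hinj : Function.Injective (fun p : ℕ+ × ℕ+ => (p.1, F * p.2)) := by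
    rintro ⟨a, b⟩ ⟨c, d⟩ h
    simp only [Prod.mk.injEq, mul_right_inj] at h
    exact Prod.ext h.1 h.2
  have H := hasSum_sum (s := Finset.range f) fun a _ =>
    hasSum_sum (s := Finset.range (f ^ 2)) fun b _ =>
      (hasSum_P f (ε * a) (ε * b) z).mul_left (χ (a : ZMod f) * χ (b : ZMod f))
  have hfac : ∀ p : ℕ+ × ℕ+, (∑ a ∈ Finset.range f, ∑ b ∈ Finset.range (f ^ 2),
      χ (a : ZMod f) * χ (b : ZMod f) *
      ((if ((p.1 : ℕ) : ZMod f) = ((ε * a : ℤ) : ZMod f) then (1 : ℂ) else 0) *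
        ((p.1 / f : ℂ) * cexp (2 * Real.pi * I * ((p.2 : ℂ) * p.1 * z / f)) *
          cexp (2 * Real.pi * I * (p.2 * ((ε * b : ℤ) : ℂ)) / (f : ℂ) ^ 2)))) =
      ((p.1 / f : ℂ) * cexp (2 * Real.pi * I * ((p.2 : ℂ) * p.1 * z / f))) *
      (χ ((ε * p.1 : ℤ) : ZMod f) * if (f : ℤ) ∣ ε * p.2 then
        f * (χ (((ε * p.2) / f : ℤ) : ZMod f) * gauss χ) else 0) := by
    intro p
    rw [← char_sum_sq_level hχ hq, ← sum_char_indicator ε hε, Finset.sum_mul_sum, Finset.mul_sum]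
    refine Finset.sum_congr rfl fun a _ => ?_
    rw [Finset.mul_sum]
    refine Finset.sum_congr rfl fun b _ => ?_
    push_cast
    rw [show (p.2 : ℂ) * ((ε : ℂ) * b) = ε * p.2 * b by ring]
    ring
  rw [← hinj.hasSum_iff] at H
  · refine H.congr_fun fun p => ?_
    rw [Function.comp_apply, hfac]
    have h1 : (((F * p.2 : ℕ+) : ℕ) : ℤ) = f * p.2 := by
      rw [PNat.mul_coe, hF]; push_cast; rfl
    have h2 : (((F * p.2 : ℕ+) : ℕ) : ℂ) = f * p.2 := by
      rw [PNat.mul_coe, hF]; push_cast; rfl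
    simp only [h1, h2]
    rw [if_pos ⟨ε * p.2, by ring⟩, show ε * ((f : ℤ) * p.2) = f * (ε * p.2) by ring,
      Int.mul_ediv_cancel_left _ hfz]
    have h3 : χ ((ε * (p.1 : ℕ) : ℤ) : ZMod f) * χ ((ε * (p.2 : ℕ) : ℤ) : ZMod f) =
        χ ((p.1 * p.2 : ℕ) : ZMod f) := by
      rw [← map_mul]
      congr 1
      have hε' : ((ε : ZMod f)) * ε = 1 := by exact_mod_cast congrArg (Int.cast : ℤ → ZMod f) hε
      push_cast
      linear_combination ((p.1 : ℕ) * (p.2 : ℕ) : ZMod f) * hε'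
    rw [← h3, show 2 * Real.pi * I * ((f : ℂ) * p.2 * p.1 * z / f) =
      2 * Real.pi * I * ((p.1 : ℂ) * p.2 * z) by field_simp]
    field_simp
  -- Outside the range of m' ↦ fm' the character sum over b vanishes.
  · rintro ⟨j, m⟩ hm
    rw [hfac]
    rw [if_neg, mul_zero, mul_zero]
    intro hd
    apply hm
    have hd' : f ∣ (m : ℕ) := by
      have : (f : ℤ) ∣ ε * (ε * m) := hd.mul_left ε
      rw [← mul_assoc, hε, one_mul] at this
      exact_mod_cast this
    obtain ⟨k, hk⟩ := hd'
    have hk0 : 0 < k := by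
      rcases Nat.eq_zero_or_pos k with h | h
      · rw [h, mul_zero] at hk; exact absurd hk m.pos.ne'
      · exact h
    exact ⟨(j, ⟨k, hk0⟩), Prod.ext rfl (PNat.eq (by rw [PNat.mul_coe, hF]; exact hk.symm))⟩

lemma sum_char_range (hχ : χ.IsPrimitive) (hf : f ≠ 1) :
    ∑ u ∈ Finset.range f, χ (u : ZMod f) = 0 := by
  rw [sum_range_eq_sum_zmod]
  refine MulChar.sum_eq_zero_of_ne_one fun h => hf ?_
  rw [DirichletCharacter.isPrimitive_def, h, DirichletCharacter.conductor_one] at hχ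
  exact hχ.symm

lemma sum_char_range_sq (hχ : χ.IsPrimitive) (hf : f ≠ 1) :
    ∑ u ∈ Finset.range (f ^ 2), χ (u : ZMod f) = 0 := by
  rw [pow_two, sum_range_mul]
  simp [sum_char_range hχ hf]

/-- For a primitive quadratic character `χ`, `E_χ` is the twist of the Eisenstein series of level
one by `χ`. -/
theorem EPrim_eq (hχ : χ.IsPrimitive) (hq : χ.IsQuadratic) (hf : (f : ℝ) ≠ 0) :
    EPrim χ = ∑ u ∈ Finset.range f,
      ((gauss χ)⁻¹ * χ (u : ZMod f)) • (eisStar ∣[(2 : ℤ)] transGL f u hf) := by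
  ext z
  choose w hw1 hw2 using fun u => eisStar_slash_transGL f u hf z
  choose S hS1 hS2 using fun u => hasSum_E2 (w u)
  have hS3 : ∀ u : ℕ, HasSum (fun p : ℕ+ × ℕ+ =>
      (p.1 : ℂ) * cexp (2 * Real.pi * I * ((p.1 : ℂ) * p.2 * (z + u / f)))) (S u) := by
    intro u
    have := hS1 u
    rwa [hw1] at this
  have e0 := hasSum_twist hχ hq z S hS3
  have e1 := (hasSum_char_P hχ hq z 1 (by norm_num)).unique e0
  have e2 := (hasSum_char_P hχ hq z (-1) (by norm_num)).unique e0
  set T := ∑ u ∈ Finset.range f, χ (u : ZMod f) * S u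
  have hR : (∑ u ∈ Finset.range f,
      ((gauss χ)⁻¹ * χ (u : ZMod f)) • (eisStar ∣[(2 : ℤ)] transGL f u hf)) z =
      (gauss χ)⁻¹ * (T + (∑ u ∈ Finset.range f, χ (u : ZMod f)) *
        (-1 / 24 + 1 / (8 * Real.pi * z.im))) := by
    rw [Finset.sum_apply, Finset.sum_mul, ← Finset.sum_add_distrib, Finset.mul_sum]
    refine Finset.sum_congr rfl fun u _ => ?_
    rw [Pi.smul_apply, smul_eq_mul, hw2, hS2]
    ring
  -- The coprimality filters are redundant, since χ vanishes on the discarded residues.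
  have hfilter : ∑ a ∈ (Finset.range f).filter (fun a => a.Coprime f),
      ∑ b ∈ (Finset.range (f ^ 2)).filter (fun b => b.Coprime (f ^ 2)),
        χ (a : ZMod f) * χ (b : ZMod f) * phi ((a : ℚ) / f) ((b : ℚ) / (f : ℚ) ^ 2) z =
      ∑ a ∈ Finset.range f, ∑ b ∈ Finset.range (f ^ 2),
        χ (a : ZMod f) * χ (b : ZMod f) * phi ((a : ℚ) / f) ((b : ℚ) / (f : ℚ) ^ 2) z := by
    rw [Finset.sum_filter]
    refine Finset.sum_congr rfl fun a _ => ?_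
    split_ifs with ha
    · rw [Finset.sum_filter]
      refine Finset.sum_congr rfl fun b _ => ?_
      split_ifs with hb
      · rfl
      · rw [char_eq_zero_of_not_coprime (n := b), mul_zero, zero_mul]
        exact fun h => hb (h.pow_right 2)
    · simp [char_eq_zero_of_not_coprime ha]
  have hsplit : ∑ a ∈ Finset.range f, ∑ b ∈ Finset.range (f ^ 2),
        χ (a : ZMod f) * χ (b : ZMod f) * phi ((a : ℚ) / f) ((b : ℚ) / (f : ℚ) ^ 2) z =
      ∑ a ∈ Finset.range f, ∑ b ∈ Finset.range (f ^ 2), χ (a : ZMod f) * χ (b : ZMod f) *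
        (1 / 2 * (B2 ((a : ℚ) / f) : ℂ) - delta ((a : ℚ) / f) ((b : ℚ) / (f : ℚ) ^ 2) *
          (I / (2 * Real.pi * ((z : ℂ) - (starRingEnd ℂ) (z : ℂ))))) - 2 * T := by
    have h2T := (two_mul T).trans (congrArg₂ (· + ·) e1.symm e2.symm)
    rw [h2T, ← Finset.sum_add_distrib, ← Finset.sum_sub_distrib]
    refine Finset.sum_congr rfl fun a _ => ?_
    rw [← Finset.sum_add_distrib, ← Finset.sum_sub_distrib]
    refine Finset.sum_congr rfl fun b _ => ?_
    rw [phi]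
    push_cast
    rw [neg_mul, neg_mul, one_mul, one_mul, neg_div, neg_div]
    ring
  -- For f = 1 the two constants are 1/12 - 1/(4πy) and -2(-1/24 + 1/(8πy)). For f > 1 both sides
  -- vanish by orthogonality, as δ is nonzero only where χ(a) = 0.
  have hconst : ∑ a ∈ Finset.range f, ∑ b ∈ Finset.range (f ^ 2), χ (a : ZMod f) * χ (b : ZMod f) *
        (1 / 2 * (B2 ((a : ℚ) / f) : ℂ) - delta ((a : ℚ) / f) ((b : ℚ) / (f : ℚ) ^ 2) *
          (I / (2 * Real.pi * ((z : ℂ) - (starRingEnd ℂ) (z : ℂ))))) =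
      -2 * ((∑ u ∈ Finset.range f, χ (u : ZMod f)) * (-1 / 24 + 1 / (8 * Real.pi * z.im))) := by
    by_cases hf1 : f = 1
    · subst hf1
      have hz : (z : ℂ) - (starRingEnd ℂ) (z : ℂ) = 2 * z.im * I := by
        rw [Complex.sub_conj]; push_cast; rfl
      have hpi : (Real.pi : ℂ) ≠ 0 := by exact_mod_cast Real.pi_ne_zero
      have hy : (z.im : ℂ) ≠ 0 := by exact_mod_cast z.im_pos.ne'
      have h1 : χ 0 = 1 := by rw [DirichletCharacter.level_one χ]; exact map_one _
      rw [hz]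
      simp only [one_pow, Finset.range_one, Finset.sum_singleton, Nat.cast_zero, h1, B2, delta]
      simp
      field_simp
      ring
    · rw [sum_char_range hχ hf1, zero_mul, mul_zero]
      have : ∀ a ∈ Finset.range f, ∑ b ∈ Finset.range (f ^ 2), χ (a : ZMod f) * χ (b : ZMod f) *
        (1 / 2 * (B2 ((a : ℚ) / f) : ℂ) - delta ((a : ℚ) / f) ((b : ℚ) / (f : ℚ) ^ 2) *
          (I / (2 * Real.pi * ((z : ℂ) - (starRingEnd ℂ) (z : ℂ))))) =
          (χ (a : ZMod f) * (1 / 2 * (B2 ((a : ℚ) / f) : ℂ))) *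
            ∑ b ∈ Finset.range (f ^ 2), χ (b : ZMod f) := by
        intro a ha
        rw [Finset.mul_sum]
        refine Finset.sum_congr rfl fun b _ => ?_
        by_cases ha0 : a = 0
        · subst ha0
          rw [Nat.cast_zero, χ.map_zero' hf1]
          simp
        · have hd : delta ((a : ℚ) / f) ((b : ℚ) / (f : ℚ) ^ 2) = 0 := by
            have hfp : (0 : ℚ) < f := by exact_mod_cast Nat.pos_of_ne_zero (NeZero.ne f)
            have hap : (0 : ℚ) < a := by exact_mod_cast Nat.pos_of_ne_zero ha0
            have hlt : (a : ℚ) < f := by exact_mod_cast Finset.mem_range.mp ha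
            rw [delta, if_neg]
            rintro ⟨h, -⟩
            rw [Int.fract_eq_self.mpr ⟨by positivity, by rwa [div_lt_one hfp]⟩] at h
            exact (div_pos hap hfp).ne' h
          rw [hd]; ring
      rw [Finset.sum_congr rfl this]
      simp [sum_char_range_sq hχ hf1]
  rw [hR, EPrim, hfilter, hsplit, hconst, mul_comm 2 (gauss χ), ← div_div]
  ring

end characters

/-! ### Character sums of squared gcds -/

/-- Jordan's totient `J₂(n) = ∑_{e ∣ n} μ(e) (n / e)²`. -/
def jordanTwo (n : ℕ) : ℂ :=
  ∑ x ∈ n.divisorsAntidiagonal, (ArithmeticFunction.moebius x.1 : ℂ) * (x.2 : ℂ) ^ 2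

lemma sum_divisors_jordanTwo {n : ℕ} (hn : 0 < n) :
    ∑ e ∈ n.divisors, jordanTwo e = (n : ℂ) ^ 2 :=
  (ArithmeticFunction.sum_eq_iff_sum_mul_moebius_eq (f := jordanTwo)
    (g := fun n : ℕ => (n : ℂ) ^ 2)).mpr (fun _ _ => rfl) n hn

section characters

variable {f : ℕ} [NeZero f] {χ : DirichletCharacter ℂ f}

/-- Otherwise χ would factor through modulus e, and its conductor f would divide e. -/
lemma exists_unit_char_ne_one (hχ : χ.IsPrimitive) {e : ℕ} (he : e ∣ f) (hef : e ≠ f) :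
    ∃ k : (ZMod f)ˣ, ZMod.castHom he (ZMod e) (k : ZMod f) = 1 ∧ χ (k : ZMod f) ≠ 1 := by
  by_contra! h
  have hF : χ.FactorsThrough e := by
    rw [DirichletCharacter.factorsThrough_iff_ker_unitsMap he]
    intro k hk
    rw [MonoidHom.mem_ker] at hk ⊢
    apply Units.ext
    rw [MulChar.coe_toUnitHom, Units.val_one]
    apply h
    have := congrArg Units.val hk
    simpa [ZMod.unitsMap_def] using this
  have := DirichletCharacter.conductor_dvd_of_mem_conductorSet (χ := χ) hF
  rw [hχ] at this
  exact hef (Nat.dvd_antisymm he this)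

/-- Substituting ku for u, with k ≡ 1 mod e and χ(k) ≠ 1, preserves Φ on units and multiplies the
sum by χ(k). -/
lemma sum_char_mul_eq_zero (hχ : χ.IsPrimitive) {e : ℕ} (he : e ∣ f) (hef : e ≠ f)
    (Φ : ZMod f → ℂ) (hΦ : ∀ u v : ZMod f, IsUnit u → IsUnit v →
      ZMod.castHom he (ZMod e) u = ZMod.castHom he (ZMod e) v → Φ u = Φ v) :
    ∑ u : ZMod f, χ u * Φ u = 0 := by
  obtain ⟨k, hk, hk1⟩ := exists_unit_char_ne_one hχ he hef
  have h1 : ∑ u : ZMod f, χ u * Φ u = χ k * ∑ u : ZMod f, χ u * Φ u := by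
    refine (Equiv.sum_comp k.mulLeft (fun u => χ u * Φ u)).symm.trans ?_
    rw [Finset.mul_sum]
    refine Finset.sum_congr rfl fun u _ => ?_
    simp only [Units.mulLeft_apply, map_mul, mul_assoc]
    by_cases hu : IsUnit u
    · rw [hΦ (k * u) u (k.isUnit.mul hu) hu (by rw [map_mul, hk, one_mul])]
    · rw [χ.map_nonunit hu]; simp
  have h2 : (1 - χ k) * ∑ u : ZMod f, χ u * Φ u = 0 := by linear_combination h1
  exact (mul_eq_zero.mp h2).resolve_left (sub_ne_zero.mpr hk1.symm)

lemma gcd_intCast_val (n : ℤ) : Nat.gcd (n : ZMod f).val f = Int.gcd n f := by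
  have : (((n : ZMod f).val : ℕ) : ℤ) = n % f := ZMod.val_intCast n
  rw [← Int.gcd_natCast_natCast, this, Int.gcd_emod]

lemma gcd_val_unit_mul {v : ZMod f} (hv : IsUnit v) (z : ZMod f) :
    Nat.gcd (v * z).val f = Nat.gcd z.val f := by
  have hvc : v.val.Coprime f := by
    have := (ZMod.isUnit_iff_coprime v.val f).mp (by rwa [ZMod.natCast_zmod_val])
    exact this
  have h := gcd_intCast_val (f := f) (v.val * z.val : ℤ)
  push_cast at h
  rw [ZMod.natCast_zmod_val, ZMod.natCast_zmod_val] at h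
  rw [h, ← Nat.cast_mul, Int.gcd_natCast_natCast]
  exact Nat.Coprime.gcd_mul_left_cancel _ hvc

/-- A primitive character picks out the Möbius inverse of a function of `gcd(w - 1, f)`. -/
lemma sum_char_gcd_sub_one (hχ : χ.IsPrimitive) :
    ∑ w : ZMod f, χ w * (Nat.gcd (w - 1).val f : ℂ) ^ 2 = jordanTwo f := by
  have hf0 : f ≠ 0 := NeZero.ne f
  -- Expand n² = ∑_{e ∣ n} J₂(e). Each proper divisor e of f contributes a function of w mod e,
  -- which is orthogonal to χ; e = f leaves only w = 1.
  have hexp : ∀ w : ZMod f, (Nat.gcd (w - 1).val f : ℂ) ^ 2 =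
      ∑ e ∈ f.divisors, if e ∣ (w - 1).val then jordanTwo e else 0 := by
    intro w
    rw [← sum_divisors_jordanTwo (Nat.gcd_pos_of_pos_right _ (Nat.pos_of_ne_zero hf0)),
      ← Finset.sum_filter]
    refine Finset.sum_congr ?_ fun _ _ => rfl
    ext e
    simp only [Nat.mem_divisors, Finset.mem_filter, Nat.dvd_gcd_iff]
    have : Nat.gcd (w - 1).val f ≠ 0 := (Nat.gcd_pos_of_pos_right _ (Nat.pos_of_ne_zero hf0)).ne'
    tauto
  simp_rw [hexp, Finset.mul_sum]
  rw [Finset.sum_comm, Finset.sum_eq_single f]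
  · have : ∀ w : ZMod f, χ w * (if f ∣ (w - 1).val then jordanTwo f else 0) =
        if w = 1 then jordanTwo f else 0 := by
      intro w
      have hw : f ∣ (w - 1).val ↔ w = 1 := by
        rw [← ZMod.natCast_eq_zero_iff, ZMod.natCast_zmod_val, sub_eq_zero]
      by_cases h : w = 1
      · rw [if_pos h, if_pos (hw.mpr h), h, map_one, one_mul]
      · rw [if_neg h, if_neg (fun h' => h (hw.mp h')), mul_zero]
    simp [this]
  · intro e he hef
    have hd := Nat.dvd_of_mem_divisors he
    refine sum_char_mul_eq_zero hχ hd hef _ fun u v _ _ huv => ?_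
    have key : ∀ w : ZMod f, e ∣ (w - 1).val ↔ ZMod.castHom hd (ZMod e) w = 1 := by
      intro w
      have h : (((w - 1).val : ℕ) : ZMod e) = ZMod.castHom hd (ZMod e) w - 1 := by
        rw [← map_one (ZMod.castHom hd (ZMod e)), ← map_sub, ZMod.castHom_apply, ZMod.natCast_val]
      rw [← ZMod.natCast_eq_zero_iff, h, sub_eq_zero]
    simp only [key, huv]
  · intro h
    exact absurd (Nat.mem_divisors_self f hf0) h

end characters

lemma gcd_mul_prime_eq {p : ℕ} (hp : p.Prime) {N X : ℕ} (h : p ∣ N → p ∣ X ∧ ¬ p ^ 2 ∣ N) :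
    Nat.gcd N (p * X) = Nat.gcd N X := by
  apply Nat.dvd_antisymm
  · refine Nat.dvd_gcd (Nat.gcd_dvd_left _ _) ?_
    have hg := Nat.gcd_dvd_right N (p * X)
    have hgN := Nat.gcd_dvd_left N (p * X)
    by_cases hpg : p ∣ Nat.gcd N (p * X)
    · obtain ⟨g', hg'⟩ := hpg
      obtain ⟨h1, h2⟩ := h ((Dvd.intro g' hg'.symm).trans hgN)
      rw [hg'] at hg hgN ⊢
      have hgX : g' ∣ X := Nat.dvd_of_mul_dvd_mul_left hp.pos hg
      have hpg' : ¬ p ∣ g' := by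
        rintro ⟨k, rfl⟩
        exact h2 ((Dvd.intro k (by ring)).trans hgN)
      exact Nat.Coprime.mul_dvd_of_dvd_of_dvd ((hp.coprime_iff_not_dvd).mpr hpg') h1 hgX
    · exact Nat.Coprime.dvd_of_dvd_mul_left ((hp.coprime_iff_not_dvd.mpr hpg).symm) hg
  · exact Nat.gcd_dvd_gcd_mul_left_right _ _ _

lemma dvd_of_squarefree_of_primes {f : ℕ} (hf : Squarefree f) {c : ℤ}
    (h : ∀ p : ℕ, p.Prime → p ∣ f → (p : ℤ) ∣ c) : (f : ℤ) ∣ c := by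
  rw [Int.natCast_dvd, ← Nat.prod_primeFactors_of_squarefree hf]
  refine Finset.prod_primes_dvd _ (fun p hp => (Nat.prime_of_mem_primeFactors hp).prime) ?_
  intro p hp
  exact Int.natCast_dvd.mp (h p (Nat.prime_of_mem_primeFactors hp) (Nat.dvd_of_mem_primeFactors hp))

/-- As f is square-free, both sides say that v_p(c) = 1 at every prime p ∣ f. -/
lemma gcd_sq_eq_iff {f : ℕ} (hf : Squarefree f) (c : ℤ) :
    Int.gcd c ((f : ℤ) ^ 2) = f ↔ ∀ p : ℕ, p.Prime → p ∣ f → (p : ℤ) ∣ c ∧ ¬ (p : ℤ) ^ 2 ∣ c := by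
  have hf0 : f ≠ 0 := hf.ne_zero
  constructor
  · intro h p hp hpf
    have hpf' : (p : ℤ) ∣ f := Int.natCast_dvd_natCast.mpr hpf
    have h1 : (f : ℤ) ∣ c := by
      have := Int.gcd_dvd_left c ((f : ℤ) ^ 2)
      rwa [h] at this
    refine ⟨hpf'.trans h1, fun h2 => ?_⟩
    have h3 : (p : ℤ) ^ 2 ∣ Int.gcd c ((f : ℤ) ^ 2) := Int.dvd_coe_gcd h2 (pow_dvd_pow_of_dvd hpf' 2)
    rw [h] at h3
    have h4 : p * p ∣ f := by
      rw [← pow_two]; exact_mod_cast h3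
    exact hp.one_lt.ne' (Nat.isUnit_iff.mp (hf p h4))
  · intro h
    obtain ⟨c', rfl⟩ := dvd_of_squarefree_of_primes hf fun p hp hpf => (h p hp hpf).1
    rw [pow_two, Int.gcd_mul_left, Int.natAbs_natCast]
    have : Int.gcd c' f = 1 := by
      by_contra hne
      obtain ⟨p, hp, hpd⟩ := Nat.exists_prime_and_dvd hne
      have hpf : p ∣ f := by
        have : (p : ℤ) ∣ f := (Int.natCast_dvd_natCast.mpr hpd).trans (Int.gcd_dvd_right _ _)
        exact_mod_cast this
      have hpc : (p : ℤ) ∣ c' := (Int.natCast_dvd_natCast.mpr hpd).trans (Int.gcd_dvd_left _ _)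
      refine (h p hp hpf).2 ?_
      rw [pow_two]
      exact mul_dvd_mul (Int.natCast_dvd_natCast.mpr hpf) hpc
    rw [this, mul_one]

/-- If v_p(c) ≠ 1, one factor p can be dropped from fc in the gcd. When p ∤ c the first entry is
prime to p; when p² ∣ c it has p-adic valuation exactly 1, while p still divides ec. The remaining
gcd with ec sees u only modulo e. -/
lemma gcd_translate_eq {f : ℕ} (hf : Squarefree f) {p e d u v : ℕ} (hp : p.Prime)
    (hfe : f = p * e) (hd : d.Coprime f) {a c : ℤ} (hac : IsCoprime a c)
    (hpc : ¬ ((p : ℤ) ∣ c ∧ ¬ (p : ℤ) ^ 2 ∣ c)) (hu : u.Coprime f) (hv : v.Coprime f)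
    (huv : (e : ℤ) ∣ (u : ℤ) - v) :
    Int.gcd (f * (d * a) + u * c) (f * c) = Int.gcd (f * (d * a) + v * c) (f * c) := by
  have hpf : (p : ℤ) ∣ f := ⟨e, by rw [hfe]; push_cast; rfl⟩
  have hpp : Prime (p : ℤ) := Nat.prime_iff_prime_int.mp hp
  have hpdvd : p ∣ f := ⟨e, hfe⟩
  have step : ∀ w : ℕ, w.Coprime f →
      Int.gcd (f * (d * a) + w * c) (f * c) = Int.gcd (f * (d * a) + w * c) (e * c) := by
    intro w hw
    have hcop : ∀ x : ℕ, x.Coprime f → ¬ (p : ℤ) ∣ x := fun x hx hpx => by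
      have hpx' : p ∣ x := by exact_mod_cast hpx
      have := Nat.dvd_gcd hpx' hpdvd
      rw [hx] at this
      exact hp.one_lt.ne' (Nat.dvd_one.mp this)
    rw [show (f : ℤ) * c = p * (e * c) by rw [hfe]; push_cast; ring]
    rw [Int.gcd_def, Int.gcd_def (_ : ℤ) (e * c), Int.natAbs_mul (p : ℤ), Int.natAbs_natCast]
    refine gcd_mul_prime_eq hp fun hN => ?_
    rw [← Int.natCast_dvd] at hN
    have hwc : (p : ℤ) ∣ w * c := by
      have h1 := dvd_sub hN (hpf.mul_right (d * a))
      rwa [add_sub_cancel_left] at h1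
    have hc : (p : ℤ) ∣ c := (hpp.dvd_or_dvd hwc).resolve_left (hcop w hw)
    have hc2 : (p : ℤ) ^ 2 ∣ c := by
      by_contra h; exact hpc ⟨hc, h⟩
    refine ⟨Int.natCast_dvd.mp (hc.mul_left _), fun h2 => ?_⟩
    have h2' : (p : ℤ) ^ 2 ∣ f * (d * a) + w * c := by
      rw [← Nat.cast_pow]
      exact Int.natCast_dvd.mpr h2
    have h3 := dvd_sub h2' (hc2.mul_left w)
    rw [add_sub_cancel_right, hfe, pow_two] at h3
    push_cast at h3
    rw [mul_assoc] at h3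
    have h4 := Int.dvd_of_mul_dvd_mul_left hpp.ne_zero h3
    rcases hpp.dvd_or_dvd h4 with h5 | h5
    · have : p * p ∣ f := by
        rw [hfe]; exact mul_dvd_mul_left p (by exact_mod_cast h5)
      exact hp.one_lt.ne' (Nat.isUnit_iff.mp (hf p this))
    · rcases hpp.dvd_or_dvd h5 with h6 | h6
      · exact hcop d hd h6
      · exact hpp.not_isUnit (hac.isUnit_of_dvd' h6 hc)
  rw [step u hu, step v hv]
  obtain ⟨k, hk⟩ := huv
  rw [show (f : ℤ) * (d * a) + u * c = f * (d * a) + v * c + k * (e * c) by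
    linear_combination c * hk]
  exact Int.gcd_add_mul_right_left ..

section characters

variable {f : ℕ} [NeZero f] {χ : DirichletCharacter ℂ f}

/-- The substitution z = -A C⁻¹ w turns A + zC into -A(w - 1), and units do not affect the gcd with
f; χ(C⁻¹) = χ(C) because χ is quadratic. -/
lemma sum_char_gcd_linear (hχ : χ.IsPrimitive) (hq : χ.IsQuadratic) {A C : ZMod f}
    (hA : IsUnit A) (hC : IsUnit C) :
    ∑ z : ZMod f, χ z * (Nat.gcd (A + z * C).val f : ℂ) ^ 2 =
      χ (-1) * χ A * χ C * jordanTwo f := by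
  obtain ⟨A, rfl⟩ := hA
  obtain ⟨C, rfl⟩ := hC
  rw [← sum_char_gcd_sub_one hχ, Finset.mul_sum,
    ← Equiv.sum_comp (-A * C⁻¹).mulLeft
      (fun z : ZMod f => χ z * (Nat.gcd ((A : ZMod f) + z * C).val f : ℂ) ^ 2)]
  refine Finset.sum_congr rfl fun w _ => ?_
  have h1 : (A : ZMod f) + ((-A * C⁻¹ : (ZMod f)ˣ) : ZMod f) * w * C =
      ((-A : (ZMod f)ˣ) : ZMod f) * (w - 1) := by
    push_cast
    have : ((C⁻¹ : (ZMod f)ˣ) : ZMod f) * C = 1 := C.inv_mul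
    linear_combination (-(A : ZMod f) * w) * this
  have h2 : χ ((C⁻¹ : (ZMod f)ˣ) : ZMod f) = χ C := by
    have h3 := char_mul_self_eq_one hq C.isUnit
    have h4 : χ ((C⁻¹ : (ZMod f)ˣ) : ZMod f) * χ C = 1 := by
      rw [← map_mul, C.inv_mul, map_one]
    have h5 : χ (C : ZMod f) ≠ 0 := fun h => by rw [h] at h3; simp at h3
    exact mul_right_cancel₀ h5 (h4.trans h3.symm)
  rw [Units.mulLeft_apply, h1, gcd_val_unit_mul (-A).isUnit, map_mul]
  push_cast
  rw [map_mul, h2, show -(A : ZMod f) = -1 * A by ring, map_mul]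
  ring

/-- The character sum giving the constant terms of the twisted Eisenstein series. -/
lemma sum_char_gcd_sq (hχ : χ.IsPrimitive) (hq : χ.IsQuadratic) (hf : Squarefree f) {d : ℕ}
    (hd : d.Coprime f) {a c : ℤ} (hac : IsCoprime a c) :
    ∑ u ∈ Finset.range f, χ (u : ZMod f) *
        (Int.gcd (f * (d * a) + u * c) (f * c) : ℂ) ^ 2 =
      if Int.gcd c ((f : ℤ) ^ 2) = f then
        (f : ℂ) ^ 2 * (Int.gcd d c : ℂ) ^ 2 *
          (χ (-1) * χ ((d * a : ℤ) : ZMod f) * χ ((c / f : ℤ) : ZMod f) * jordanTwo f)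
      else 0 := by
  have hfz : (f : ℤ) ≠ 0 := by exact_mod_cast NeZero.ne f
  split_ifs with h
  · have hfc : (f : ℤ) ∣ c := by
      have := Int.gcd_dvd_left c ((f : ℤ) ^ 2)
      rwa [h] at this
    obtain ⟨c', rfl⟩ := hfc
    have hc'f : Int.gcd c' f = 1 := by
      rw [pow_two, Int.gcd_mul_left, Int.natAbs_natCast] at h
      exact Nat.eq_of_mul_eq_mul_left (Nat.pos_of_ne_zero (NeZero.ne f)) (by rw [h, mul_one])
    have hac' : IsCoprime a c' := hac.of_mul_right_right
    have haf : IsCoprime a (f : ℤ) := hac.of_mul_right_left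
    rw [Int.mul_ediv_cancel_left _ hfz]
    have hgd : Int.gcd d (f * c') = Int.gcd d c' := by
      rw [Int.gcd_def, Int.gcd_def, Int.natAbs_mul, Int.natAbs_natCast, Int.natAbs_natCast]
      exact Nat.Coprime.gcd_mul_left_cancel_right _ hd.symm
    -- With c = fc' and c' prime to f, the gcd splits into f, a part at f depending on u, and a part
    -- at c' which is gcd(d, c') since a is prime to c'.
    have hterm : ∀ u : ℕ, Int.gcd (f * (d * a) + u * (f * c')) (f * (f * c')) =
        f * (Int.gcd d (f * c') * Nat.gcd (((d * a : ℤ) : ZMod f) + u * (c' : ZMod f)).val f) := by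
      intro u
      have h1 : Int.gcd (f * (d * a) + u * (f * c')) (f * (f * c')) =
          f * Int.gcd (d * a + u * c') (f * c') := by
        rw [show (f : ℤ) * (d * a) + u * (f * c') = f * (d * a + u * c') by ring,
          Int.gcd_mul_left, Int.natAbs_natCast]
      have h2 : Int.gcd (d * a + u * c') (f * c') =
          Int.gcd (d * a + u * c') f * Int.gcd (d * a + u * c') c' := by
        simp only [Int.gcd_def, Int.natAbs_mul, Int.natAbs_natCast]
        exact Nat.Coprime.gcd_mul _ (by
          rw [Nat.coprime_comm]; simpa [Int.gcd_def] using hc'f)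
      have h3 : Int.gcd (d * a + u * c') c' = Int.gcd d c' := by
        rw [Int.gcd_add_mul_right_left]
        simp only [Int.gcd_def, Int.natAbs_mul]
        exact Nat.Coprime.gcd_mul_right_cancel _ (Int.isCoprime_iff_gcd_eq_one.mp hac')
      have h4 := gcd_intCast_val (f := f) (d * a + u * c')
      rw [h1, h2, h3, hgd, ← h4]
      push_cast
      ring
    have hA : IsUnit ((d * a : ℤ) : ZMod f) := by
      push_cast
      refine IsUnit.mul ((ZMod.isUnit_iff_coprime d f).mpr hd) ?_
      exact (ZMod.coe_int_isUnit_iff_isCoprime a f).mpr haf.symm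
    have hC : IsUnit (c' : ZMod f) :=
      (ZMod.coe_int_isUnit_iff_isCoprime c' f).mpr (Int.isCoprime_iff_gcd_eq_one.mpr hc'f).symm
    rw [← sum_char_gcd_linear hχ hq hA hC,
      ← sum_range_eq_sum_zmod (fun z : ZMod f => χ z *
        (Nat.gcd (((d * a : ℤ) : ZMod f) + z * (c' : ZMod f)).val f : ℂ) ^ 2), Finset.mul_sum]
    refine Finset.sum_congr rfl fun u _ => ?_
    rw [hterm]
    push_cast
    ring
  · rw [gcd_sq_eq_iff hf] at h
    push Not at h
    obtain ⟨p, hp, hpf, hpc⟩ := h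
    obtain ⟨e, he⟩ := hpf
    have hef : e ∣ f := ⟨p, by rw [he]; ring⟩
    have hne : e ≠ f := by
      intro h'
      rw [h'] at he
      have : 1 * f = p * f := by rw [one_mul]; exact he
      exact hp.one_lt.ne (Nat.eq_of_mul_eq_mul_right (Nat.pos_of_ne_zero (NeZero.ne f)) this)
    -- At a prime p ∣ f with v_p(c) ≠ 1 the gcd factors through u mod f/p on units, so primitivity
    -- kills the sum.
    have hz := sum_char_mul_eq_zero hχ hef hne
      (fun z => (Int.gcd (f * (d * a) + z.val * c) (f * c) : ℂ) ^ 2) ?_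
    · rw [← sum_range_eq_sum_zmod (fun z : ZMod f => χ z *
        (Int.gcd (f * (d * a) + z.val * c) (f * c) : ℂ) ^ 2)] at hz
      rw [← hz]
      refine Finset.sum_congr rfl fun u hu => ?_
      rw [ZMod.val_cast_of_lt (Finset.mem_range.mp hu)]
    · intro u v hu hv huv
      have hcop : ∀ w : ZMod f, IsUnit w → w.val.Coprime f := fun w hw =>
        (ZMod.isUnit_iff_coprime w.val f).mp (by rwa [ZMod.natCast_zmod_val])
      have hdvd : (e : ℤ) ∣ (u.val : ℤ) - v.val := by
        rw [← ZMod.intCast_zmod_eq_zero_iff_dvd]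
        push_cast
        rw [ZMod.natCast_val, ZMod.natCast_val, sub_eq_zero]
        exact huv
      rw [gcd_translate_eq hf hp he hd hac (fun h' => h'.2 (hpc h'.1)) (hcop u hu) (hcop v hv) hdvd]

end characters

/-! ### The Bernoulli sum n_χ -/

lemma B2_intCast_div (f : ℕ) [NeZero f] (n : ℤ) :
    B2 ((n : ℚ) / f) = B2 (((n : ZMod f).val : ℚ) / f) := by
  have hf : (f : ℚ) ≠ 0 := NeZero.ne _
  have h : (((n : ZMod f).val : ℕ) : ℤ) = n % f := ZMod.val_intCast n
  have h2 : (n : ℚ) / f = ((n : ZMod f).val : ℚ) / f + ((n / f : ℤ) : ℚ) := by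
    have h3 : (n : ℚ) = (n % f : ℤ) + f * (n / f : ℤ) := by
      exact_mod_cast (Int.emod_add_mul_ediv n f).symm
    have h4 : (((n : ZMod f).val : ℕ) : ℚ) = ((n % f : ℤ) : ℚ) := by exact_mod_cast h
    rw [h4]
    nth_rw 1 [h3]
    field_simp
  rw [B2, h2, Int.fract_add_intCast, ← B2]

lemma sum_range_B2_polynomial (d : ℕ) (D : ℚ) :
    ∑ n ∈ Finset.range d, (((n : ℚ) / D) ^ 2 - n / D + 1 / 6) =
      ((d : ℚ) - 1) * d * (2 * d - 1) / 6 / D ^ 2 - d * (d - 1) / 2 / D + d / 6 := by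
  induction d with
  | zero => simp
  | succ d ih =>
    rw [Finset.sum_range_succ, ih]
    push_cast
    ring

lemma sum_range_B2 {d : ℕ} (hd : 0 < d) :
    ∑ n ∈ Finset.range d, B2 ((n : ℚ) / d) = 1 / (6 * d) := by
  have hd' : (0 : ℚ) < d := by exact_mod_cast hd
  rw [Finset.sum_congr rfl (g := fun n : ℕ => (((n : ℚ) / d) ^ 2 - n / d + 1 / 6)),
    sum_range_B2_polynomial]
  · field_simp; ring
  · intro n hn
    have hn' : (n : ℚ) < d := by exact_mod_cast Finset.mem_range.mp hn
    rw [B2, Int.fract_eq_self.mpr ⟨by positivity, by rwa [div_lt_one hd']⟩]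

lemma sum_range_mul_ite_dvd {R : Type*} [AddCommMonoid R] (F : ℕ → R) {d : ℕ} (hd : 0 < d) (k : ℕ) :
    ∑ b ∈ Finset.range (d * k), (if d ∣ b then F b else 0) = ∑ j ∈ Finset.range k, F (d * j) := by
  rw [sum_range_mul]
  refine Finset.sum_congr rfl fun j _ => ?_
  rw [Finset.sum_eq_single 0]
  · simp
  · intro b hb hb0
    rw [if_neg]
    rw [Nat.dvd_add_right (Dvd.intro j rfl)]
    exact fun h => hb0 (Nat.eq_zero_of_dvd_of_lt h (Finset.mem_range.mp hb))
  · simp [hd.ne']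

lemma sum_range_exp {k : ℕ} (hk : 0 < k) (n : ℕ) :
    ∑ u ∈ Finset.range k, cexp (2 * Real.pi * I * (u * n) / k) = if k ∣ n then (k : ℂ) else 0 := by
  have hk0 : (k : ℂ) ≠ 0 := by exact_mod_cast hk.ne'
  have hterm : ∀ u : ℕ, cexp (2 * Real.pi * I * (u * n) / k) =
      cexp (2 * Real.pi * I * (n / k)) ^ u := by
    intro u
    rw [← Complex.exp_nat_mul]; congr 1; ring
  simp_rw [hterm]
  split_ifs with h
  · obtain ⟨m, rfl⟩ := h
    have : cexp (2 * Real.pi * I * ((k * m : ℕ) / k : ℂ)) = 1 := by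
      rw [Complex.exp_eq_one_iff]
      refine ⟨m, ?_⟩
      push_cast; field_simp
    simp_rw [this]
    simp
  · have h1 : cexp (2 * Real.pi * I * (n / k)) ≠ 1 := by
      intro h'
      rw [Complex.exp_eq_one_iff] at h'
      obtain ⟨m, hm⟩ := h'
      have : (n / k : ℂ) = m := mul_left_cancel₀ Complex.two_pi_I_ne_zero (by rw [hm]; ring)
      field_simp at this
      have h2 : (n : ℤ) = k * m := by exact_mod_cast this
      exact h (by exact_mod_cast Dvd.intro m h2.symm)
    rw [geom_sum_eq h1, ← Complex.exp_nat_mul]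
    have h2 : cexp (k * (2 * Real.pi * I * (n / k))) = 1 := by
      rw [Complex.exp_eq_one_iff]
      refine ⟨n, ?_⟩
      push_cast; field_simp
    rw [h2]; simp

/-- The sum of `B₂(n / f)` against Ramanujan sums. -/
lemma sum_B2_ramanujan (f : ℕ) [NeZero f] :
    ∑ n ∈ Finset.range f, (B2 ((n : ℚ) / f) : ℂ) * ∑ u ∈ Finset.range f,
      (if u.Coprime f then cexp (2 * Real.pi * I * (u * n) / f) else 0) =
      jordanTwo f / (6 * f) := by
  have hfpos : 0 < f := Nat.pos_of_ne_zero (NeZero.ne f)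
  have hf0 : (f : ℂ) ≠ 0 := NeZero.ne _
  have hram : ∀ n : ℕ, (∑ u ∈ Finset.range f,
      (if u.Coprime f then cexp (2 * Real.pi * I * (u * n) / f) else 0)) =
      ∑ x ∈ f.divisorsAntidiagonal, (ArithmeticFunction.moebius x.1 : ℂ) *
        (if x.2 ∣ n then (x.2 : ℂ) else 0) := by
    intro n
    -- Coprimality is detected by ∑_{i ∣ gcd(u, f)} μ(i), which expresses the Ramanujan sum through
    -- divisors of f.
    have h1 : ∀ u : ℕ, (if u.Coprime f then cexp (2 * Real.pi * I * (u * n) / f) else 0) =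
        ∑ x ∈ f.divisorsAntidiagonal, if x.1 ∣ u then
          (ArithmeticFunction.moebius x.1 : ℂ) * cexp (2 * Real.pi * I * (u * n) / f) else 0 := by
      intro u
      rw [Nat.sum_divisorsAntidiagonal (fun i _ => if i ∣ u then
        (ArithmeticFunction.moebius i : ℂ) * cexp (2 * Real.pi * I * (u * n) / f) else 0),
        ← Finset.sum_filter, ← Finset.sum_mul]
      have hfil : f.divisors.filter (fun e => e ∣ u) = (Nat.gcd u f).divisors := by
        ext e
        simp only [Finset.mem_filter, Nat.mem_divisors, Nat.dvd_gcd_iff]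
        have : Nat.gcd u f ≠ 0 := (Nat.gcd_pos_of_pos_right _ hfpos).ne'
        have := hfpos.ne'
        tauto
      rw [hfil]
      have hmu := congrArg (fun F => F (Nat.gcd u f)) ArithmeticFunction.moebius_mul_coe_zeta
      simp only [ArithmeticFunction.coe_mul_zeta_apply,
        ArithmeticFunction.one_apply] at hmu
      have hmu' : (∑ e ∈ (Nat.gcd u f).divisors, (ArithmeticFunction.moebius e : ℂ)) =
          if Nat.gcd u f = 1 then 1 else 0 := by exact_mod_cast congrArg (Int.cast : ℤ → ℂ) hmu
      rw [hmu']
      simp only [Nat.coprime_iff_gcd_eq_one]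
      split_ifs <;> simp
    simp_rw [h1]
    rw [Finset.sum_comm]
    refine Finset.sum_congr rfl fun x hx => ?_
    obtain ⟨hx1, -⟩ := Nat.mem_divisorsAntidiagonal.mp hx
    have hxp : 0 < x.1 ∧ 0 < x.2 := by
      constructor <;> apply Nat.pos_of_ne_zero <;> intro h <;> rw [h] at hx1 <;> simp at hx1 <;> omega
    have hx10 : (x.1 : ℂ) ≠ 0 := by exact_mod_cast hxp.1.ne'
    have hx20 : (x.2 : ℂ) ≠ 0 := by exact_mod_cast hxp.2.ne'
    rw [← sum_range_exp hxp.2, Finset.mul_sum, ← hx1,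
      sum_range_mul_ite_dvd (fun u => (ArithmeticFunction.moebius x.1 : ℂ) *
        cexp (2 * Real.pi * I * (u * n) / (x.1 * x.2 : ℕ))) hxp.1]
    refine Finset.sum_congr rfl fun u _ => ?_
    congr 2
    push_cast
    field_simp
  simp_rw [hram, Finset.mul_sum]
  rw [Finset.sum_comm, jordanTwo, Finset.sum_div]
  refine Finset.sum_congr rfl fun x hx => ?_
  obtain ⟨hx1, -⟩ := Nat.mem_divisorsAntidiagonal.mp hx
  have hxp : 0 < x.1 ∧ 0 < x.2 := by
    constructor <;> apply Nat.pos_of_ne_zero <;> intro h <;> rw [h] at hx1 <;> simp at hx1 <;> omega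
  have hx10 : (x.1 : ℂ) ≠ 0 := by exact_mod_cast hxp.1.ne'
  have hx20 : (x.2 : ℂ) ≠ 0 := by exact_mod_cast hxp.2.ne'
  have hx2 : x.2 * x.1 = f := by rw [mul_comm]; exact hx1
  have h2 : ∀ n : ℕ, (B2 ((n : ℚ) / f) : ℂ) * ((ArithmeticFunction.moebius x.1 : ℂ) *
      (if x.2 ∣ n then (x.2 : ℂ) else 0)) =
      (ArithmeticFunction.moebius x.1 : ℂ) * x.2 *
        (if x.2 ∣ n then (B2 ((n : ℚ) / f) : ℂ) else 0) := by
    intro n; split_ifs <;> ring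
  simp_rw [h2]
  rw [← Finset.mul_sum]
  -- Distribution relation for B₂ over the multiples of the cofactor; the total becomes ∑ μ(x₁)
  -- x₂/(6x₁) = J₂(f)/(6f), as x₁x₂ = f.
  have h3 : ∑ n ∈ Finset.range f, (if x.2 ∣ n then (B2 ((n : ℚ) / f) : ℂ) else 0) =
      1 / (6 * x.1) := by
    have h4 := sum_range_mul_ite_dvd (fun n => (B2 ((n : ℚ) / f) : ℂ)) hxp.2 x.1
    rw [hx2] at h4
    rw [h4]
    have h5 : (∑ j ∈ Finset.range x.1, (B2 ((j : ℚ) / x.1) : ℂ)) = 1 / (6 * x.1) := by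
      have h6 := congrArg (Rat.cast : ℚ → ℂ) (sum_range_B2 hxp.1)
      push_cast at h6
      exact h6
    rw [← h5]
    refine Finset.sum_congr rfl fun j _ => ?_
    congr 2
    rw [← hx2]
    have : (x.2 : ℚ) ≠ 0 := by exact_mod_cast hxp.2.ne'
    have : (x.1 : ℚ) ≠ 0 := by exact_mod_cast hxp.1.ne'
    push_cast
    field_simp
  rw [h3, ← hx1]
  push_cast
  field_simp

section characters

variable {f : ℕ} [NeZero f] {χ : DirichletCharacter ℂ f}

/-- After multiplication by g(χ), expand χ(n - a) g(χ) as a Gauss sum over u. The sum over a gives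
χ(-u) g(χ), and χ(u)χ(-u) = χ(-1) on units, so a Ramanujan sum remains. -/
lemma sum_char_char_sub (hχ : χ.IsPrimitive) (hq : χ.IsQuadratic) (hg : gauss χ ≠ 0) (n : ℕ) :
    ∑ a : ZMod f, χ a * χ (n - a) = χ (-1) * ∑ u ∈ Finset.range f,
      (if u.Coprime f then cexp (2 * Real.pi * I * (u * n) / f) else 0) := by
  set e := ZMod.stdAddChar (N := f)
  have hG : ∀ y : ZMod f, ∑ u : ZMod f, χ u * e (y * u) = χ y * gauss χ := by
    intro y
    have h := gaussSum_mulShift_of_isPrimitive e hχ y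
    rw [hq.inv] at h
    rw [gauss, ← h, gaussSum]
    rfl
  apply mul_right_cancel₀ hg
  have h1 : (∑ a : ZMod f, χ a * χ (n - a)) * gauss χ =
      ∑ u : ZMod f, (χ u * χ (-u) * e (n * u)) * gauss χ := by
    have h2 : ∀ a : ZMod f, χ a * χ (n - a) * gauss χ =
        ∑ u : ZMod f, χ u * e (n * u) * (χ a * e (-u * a)) := by
      intro a
      rw [mul_assoc, ← hG, Finset.mul_sum]
      refine Finset.sum_congr rfl fun u _ => ?_
      rw [show ((n : ZMod f) - a) * u = n * u + -u * a by ring, AddChar.map_add_eq_mul]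
      ring
    rw [Finset.sum_mul]
    simp_rw [h2]
    rw [Finset.sum_comm]
    refine Finset.sum_congr rfl fun u _ => ?_
    rw [← Finset.mul_sum, hG]
    ring
  rw [h1, ← Finset.sum_mul, ← sum_range_eq_sum_zmod (fun u : ZMod f => χ u * χ (-u) * e (n * u)),
    Finset.mul_sum]
  congr 1
  refine Finset.sum_congr rfl fun u _ => ?_
  split_ifs with hu
  · have hu' : IsUnit (u : ZMod f) := (ZMod.isUnit_iff_coprime u f).mpr hu
    rw [show -(u : ZMod f) = -1 * u by ring, map_mul]
    have h3 := char_mul_self_eq_one hq hu'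
    have h4 : e ((n : ZMod f) * u) = cexp (2 * Real.pi * I * (u * n) / f) := by
      have := ZMod.stdAddChar_coe (N := f) (n * u)
      push_cast at this
      rw [this]
      congr 1
      ring
    rw [h4]
    linear_combination (χ (-1) * cexp (2 * Real.pi * I * (u * n) / f)) * h3
  · rw [char_eq_zero_of_not_coprime hu]; simp

/-- The value of `n_χ` for a primitive quadratic character. -/
lemma nConst_eq (hχ : χ.IsPrimitive) (hq : χ.IsQuadratic) :
    nConst χ = (gauss χ)⁻¹ * (-1 / 24 * (χ (-1) * jordanTwo f)) := by
  -- If g(χ) were 0, both sides would be 0 by the convention for division by zero, so its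
  -- nonvanishing need not be proved.
  by_cases hg : gauss χ = 0
  · rw [nConst, hg]; simp
  have hf0 : (f : ℂ) ≠ 0 := NeZero.ne _
  have hB : ∀ a b : ℕ, (B2 (((a : ℚ) + b) / f) : ℂ) =
      (B2 ((((a : ZMod f) + b).val : ℚ) / f) : ℂ) := by
    intro a b
    have := B2_intCast_div f (a + b)
    push_cast at this
    rw [this]
  have h1 : ∑ a ∈ Finset.range f, ∑ b ∈ Finset.range f,
      χ (a : ZMod f) * χ (b : ZMod f) * (B2 (((a : ℚ) + b) / f) : ℂ) =
      χ (-1) * (jordanTwo f / (6 * f)) := by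
    simp_rw [hB]
    have h2 : ∀ a : ZMod f, ∑ b ∈ Finset.range f, χ a * χ (b : ZMod f) *
        (B2 (((a + b).val : ℚ) / f) : ℂ) =
        ∑ n : ZMod f, (B2 ((n.val : ℚ) / f) : ℂ) * (χ a * χ (n - a)) := by
      intro a
      rw [sum_range_eq_sum_zmod (fun b : ZMod f => χ a * χ b * (B2 (((a + b).val : ℚ) / f) : ℂ)),
        ← Equiv.sum_comp (Equiv.addLeft a) (fun n : ZMod f =>
          (B2 ((n.val : ℚ) / f) : ℂ) * (χ a * χ (n - a)))]
      refine Finset.sum_congr rfl fun b _ => ?_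
      rw [Equiv.coe_addLeft, add_sub_cancel_left]
      ring
    simp_rw [h2]
    rw [sum_range_eq_sum_zmod (fun a : ZMod f =>
      ∑ n : ZMod f, (B2 ((n.val : ℚ) / f) : ℂ) * (χ a * χ (n - a))), Finset.sum_comm,
      ← sum_range_eq_sum_zmod (fun n : ZMod f =>
        ∑ a : ZMod f, (B2 ((n.val : ℚ) / f) : ℂ) * (χ a * χ (n - a))), ← sum_B2_ramanujan,
      Finset.mul_sum]
    refine Finset.sum_congr rfl fun n hn => ?_
    rw [← Finset.mul_sum, sum_char_char_sub hχ hq hg, ZMod.val_cast_of_lt (Finset.mem_range.mp hn)]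
    ring
  rw [nConst, h1]
  field_simp
  ring

end characters

/-! ### Ratios of greatest common divisors -/

/-- The ratio `gcd(p d, n)² / gcd(d, n)²` for a prime `p`. -/
noncomputable def gcdRatio (n p d : ℕ) : ℂ := if p * Nat.gcd d n ∣ n then (p : ℂ) ^ 2 else 1

lemma gcd_prime_mul {p : ℕ} (hp : p.Prime) (n d : ℕ) :
    Nat.gcd (p * d) n = if p * Nat.gcd d n ∣ n then p * Nat.gcd d n else Nat.gcd d n := by
  have h1 : Nat.gcd d n ∣ Nat.gcd (p * d) n := Nat.gcd_dvd_gcd_mul_left_left ..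
  have h2 : Nat.gcd (p * d) n ∣ p * Nat.gcd d n := by
    rw [← Nat.gcd_mul_left]
    exact Nat.dvd_gcd (Nat.gcd_dvd_left _ _) ((Nat.gcd_dvd_right _ _).mul_left p)
  split_ifs with h
  · exact Nat.dvd_antisymm h2 (Nat.dvd_gcd (Nat.mul_dvd_mul_left p (Nat.gcd_dvd_left _ _)) h)
  · obtain ⟨k, hk⟩ := h1
    rw [hk] at h2 ⊢
    rcases Nat.eq_zero_or_pos (Nat.gcd d n) with h0 | h0
    · rw [h0, zero_mul]
    · rw [mul_comm p] at h2
      rcases (Nat.dvd_prime hp).mp (Nat.dvd_of_mul_dvd_mul_left h0 h2) with rfl | rfl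
      · rw [mul_one]
      · refine absurd ?_ h
        rw [mul_comm, ← hk]
        exact Nat.gcd_dvd_right _ _

lemma gcd_prime_mul_sq {p : ℕ} (hp : p.Prime) (n d : ℕ) :
    (Nat.gcd (p * d) n : ℂ) ^ 2 = gcdRatio n p d * (Nat.gcd d n : ℂ) ^ 2 := by
  rw [gcd_prime_mul hp, gcdRatio]
  split_ifs
  · push_cast; ring
  · ring

/-- The ratio at q sees only q-adic valuations, which multiplication by another prime leaves
unchanged. -/
lemma gcdRatio_prime_mul {p q : ℕ} (hp : p.Prime) (hq : q.Prime) (hpq : p ≠ q) (n d : ℕ) :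
    gcdRatio n q (p * d) = gcdRatio n q d := by
  have : q * Nat.gcd (p * d) n ∣ n ↔ q * Nat.gcd d n ∣ n := by
    constructor
    · exact (Nat.mul_dvd_mul_left q (Nat.gcd_dvd_gcd_mul_left_left ..)).trans
    · intro h
      rw [gcd_prime_mul hp]
      split_ifs with h'
      · rcases Nat.eq_zero_or_pos (Nat.gcd d n) with h0 | h0
        · rw [h0] at h ⊢; simpa using h
        · obtain ⟨m, hm⟩ := Nat.gcd_dvd_right d n
          have e1 : q ∣ m := by
            rw [hm, mul_comm q] at h
            have : Nat.gcd d (Nat.gcd d n * m) = Nat.gcd d n := by rw [← hm]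
            rw [this] at h
            exact Nat.dvd_of_mul_dvd_mul_left h0 h
          have e2 : p ∣ m := by
            rw [hm, mul_comm p] at h'
            have : Nat.gcd d (Nat.gcd d n * m) = Nat.gcd d n := by rw [← hm]
            rw [this] at h'
            exact Nat.dvd_of_mul_dvd_mul_left h0 h'
          have e3 : q * p ∣ m :=
            Nat.Coprime.mul_dvd_of_dvd_of_dvd ((Nat.coprime_primes hq hp).mpr hpq.symm) e1 e2
          have e4 := Nat.mul_dvd_mul_left (Nat.gcd d n) e3
          rw [← hm] at e4
          rwa [show q * (p * Nat.gcd d n) = Nat.gcd d n * (q * p) by ring]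
      · exact h
  simp only [gcdRatio, this]

lemma gcdRatio_one (n p : ℕ) : gcdRatio n p 1 = if p ∣ n then (p : ℂ) ^ 2 else 1 := by
  simp [gcdRatio]

lemma gcdRatio_self {p : ℕ} (hp : p.Prime) (n : ℕ) :
    gcdRatio n p p = if p ^ 2 ∣ n then (p : ℂ) ^ 2 else 1 := by
  have : p * Nat.gcd p n ∣ n ↔ p ^ 2 ∣ n := by
    by_cases h : p ∣ n
    · rw [Nat.gcd_eq_left h, pow_two]
    · rw [(hp.coprime_iff_not_dvd.mpr h), mul_one]
      exact ⟨fun h' => absurd h' h, fun h' => absurd ((Dvd.intro p (pow_two p).symm).trans h') h⟩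
  simp only [gcdRatio, this]

/-- The factor at `q` of the constant term after applying `1 - γ_q` (if `q ∈ A`) and
`1 - q⁻¹ γ_q` (if `q ∈ B`), up to characters. -/
noncomputable def localFactor (n : ℕ) (A B : Finset ℕ) (q d : ℕ) : ℂ :=
  1 - (if q ∈ A then gcdRatio n q d / q else 0) - (if q ∈ B then gcdRatio n q d / (q : ℂ) ^ 2 else 0)
    + if q ∈ A ∧ q ∈ B then gcdRatio n q d * gcdRatio n q (q * d) / (q : ℂ) ^ 3 else 0

lemma localFactor_prime_mul {p q : ℕ} (hp : p.Prime) (hq : q.Prime) (hpq : p ≠ q) (n : ℕ)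
    (A B : Finset ℕ) (d : ℕ) : localFactor n A B q (p * d) = localFactor n A B q d := by
  rw [localFactor, localFactor, gcdRatio_prime_mul hp hq hpq, mul_left_comm q p d,
    gcdRatio_prime_mul hp hq hpq]

/-- The product of local factors, times `gcd(d, n)²`. -/
noncomputable def weight (n : ℕ) (S A B : Finset ℕ) (d : ℕ) : ℂ :=
  (Nat.gcd d n : ℂ) ^ 2 * ∏ q ∈ S, localFactor n A B q d

/-- Replacing d by pd changes only the factor at p and the gcd prefactor, so the identity reduces to
`hloc` at the single prime p. -/
lemma weight_sub_eq {n : ℕ} {S A B A' B' : Finset ℕ} (hS : ∀ q ∈ S, q.Prime) {p : ℕ} (hp : p ∈ S)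
    (d : ℕ) (e : ℂ)
    (hloc : localFactor n A B p d - e * gcdRatio n p d * localFactor n A B p (p * d) =
      localFactor n A' B' p d)
    (hne : ∀ q ∈ S, q ≠ p → localFactor n A' B' q d = localFactor n A B q d) :
    weight n S A B d - e * weight n S A B (p * d) = weight n S A' B' d := by
  have hpp := hS p hp
  simp only [weight]
  rw [gcd_prime_mul_sq hpp, ← Finset.mul_prod_erase S _ hp, ← Finset.mul_prod_erase S _ hp,
    ← Finset.mul_prod_erase S _ hp, ← hloc]
  have h1 : ∏ q ∈ S.erase p, localFactor n A B q (p * d) =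
      ∏ q ∈ S.erase p, localFactor n A B q d :=
    Finset.prod_congr rfl fun q hq => localFactor_prime_mul hpp (hS q (Finset.mem_of_mem_erase hq))
      (Finset.ne_of_mem_erase hq).symm _ _ _ _
  have h2 : ∏ q ∈ S.erase p, localFactor n A' B' q d =
      ∏ q ∈ S.erase p, localFactor n A B q d :=
    Finset.prod_congr rfl fun q hq => hne q (Finset.mem_of_mem_erase hq) (Finset.ne_of_mem_erase hq)
  rw [h1, h2]
  ring

lemma weight_plus {n : ℕ} {S A : Finset ℕ} (hS : ∀ q ∈ S, q.Prime) {p : ℕ} (hp : p ∈ S)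
    (hA : p ∉ A) (d : ℕ) :
    weight n S A ∅ d - 1 / p * weight n S A ∅ (p * d) = weight n S (insert p A) ∅ d := by
  refine weight_sub_eq hS hp d _ ?_ ?_
  · simp [localFactor, hA]; ring
  · intro q _ hqp
    simp [localFactor, hqp]

lemma weight_minus {n : ℕ} {S A B : Finset ℕ} (hS : ∀ q ∈ S, q.Prime) {p : ℕ} (hp : p ∈ S)
    (hB : p ∉ B) (d : ℕ) :
    weight n S A B d - 1 / (p : ℂ) ^ 2 * weight n S A B (p * d) = weight n S A (insert p B) d := by
  have hp0 : (p : ℂ) ≠ 0 := by exact_mod_cast (hS p hp).ne_zero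
  refine weight_sub_eq hS hp d _ ?_ ?_
  · by_cases hA : p ∈ A
    · simp [localFactor, hB, hA]; field_simp; ring
    · simp [localFactor, hB, hA]; ring
  · intro q _ hqp
    simp [localFactor, hqp]

/-! ### Expansions of the stabilised Eisenstein series -/

section characters

variable {f : ℕ} {χ : DirichletCharacter ℂ f}

/-- For all `d` prime to `f`, the translate `g | diag(d, 1) γ` has an expansion with constant
term `A χ(d) d⁻¹ W(d)`. -/
def HasDiagExpansions (χ : DirichletCharacter ℂ f) (γ : SL(2, ℤ)) (g : ℍ → ℂ) (κ A : ℂ)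
    (W : ℕ → ℂ) : Prop :=
  ∀ (d : ℕ) (hd : (d : ℝ) ≠ 0), d.Coprime f →
    HasExpansion (g ∣[(2 : ℤ)] (diagGL d hd * mapGL ℝ γ)) κ (A * (χ (d : ZMod f) / d * W d))

/-- As γ_p replaces d by pd, the expansions are carried for all d at once. The χ(p) of the operator
meets the χ(p) of χ(pd) and drops out by χ(p)² = 1. The values e = 1 and e = p⁻¹ give [p]⁺ and [p]⁻.
-/
lemma HasDiagExpansions.sub_gammaOp {γ : SL(2, ℤ)} {g : ℍ → ℂ} {κ A : ℂ} {W : ℕ → ℂ}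
    (H : HasDiagExpansions χ γ g κ A W) (hq : χ.IsQuadratic) {p : ℕ} (hp : p.Prime)
    (hpf : p.Coprime f) (e : ℂ) :
    HasDiagExpansions χ γ (g - (e * χ (p : ZMod f)) • gammaOp p g) (κ - e * χ (p : ZMod f) * κ) A
      (fun d => W d - e / p * W (p * d)) := by
  intro d hd hdf
  have hpR : (p : ℝ) ≠ 0 := by exact_mod_cast hp.ne_zero
  have hpC : (p : ℂ) ≠ 0 := by exact_mod_cast hp.ne_zero
  have hdC : (d : ℂ) ≠ 0 := by exact_mod_cast hd
  have hpd : ((p * d : ℕ) : ℝ) ≠ 0 := by push_cast; exact mul_ne_zero hpR hd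
  have h1 := H d hd hdf
  have h2 := (H (p * d) hpd (Nat.Coprime.mul_left hpf hdf)).smul (-(e * χ (p : ZMod f)))
  have h3 : (g - (e * χ (p : ZMod f)) • gammaOp p g) ∣[(2 : ℤ)] (diagGL d hd * mapGL ℝ γ) =
      g ∣[(2 : ℤ)] (diagGL d hd * mapGL ℝ γ) +
        (-(e * χ (p : ZMod f))) • g ∣[(2 : ℤ)] (diagGL (p * d) hpd * mapGL ℝ γ) := by
    rw [sub_eq_add_neg, ← neg_smul, SlashAction.add_slash, smul_slash_diagGL_mul, gammaOp_eq hpR,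
      ← SlashAction.slash_mul, ← mul_assoc, diagGL_mul hpR hd hpd]
  rw [h3]
  convert h1.add h2 using 1
  · ring
  · have h4 := char_mul_self_eq_one hq ((ZMod.isUnit_iff_coprime p f).mpr hpf)
    push_cast
    rw [map_mul]
    field_simp
    linear_combination (A * χ d * e * W (p * d)) * h4

lemma HasDiagExpansions.plusOp_foldr {γ : SL(2, ℤ)} {g : ℍ → ℂ} {κ A : ℂ} {n : ℕ} {S : Finset ℕ}
    (H : HasDiagExpansions χ γ g κ A (weight n S ∅ ∅)) (hq : χ.IsQuadratic)
    (hS : ∀ q ∈ S, q.Prime) (hSf : ∀ q ∈ S, q.Coprime f) (l : List ℕ) (hl : l.Nodup)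
    (hlS : ∀ p ∈ l, p ∈ S) :
    HasDiagExpansions χ γ (l.foldr (plusOp χ) g)
      ((l.map fun p : ℕ => 1 - χ (p : ZMod f)).prod * κ) A (weight n S l.toFinset ∅) := by
  induction l with
  | nil => simpa using H
  | cons p l ih =>
    rw [List.nodup_cons] at hl
    have hp := hlS p List.mem_cons_self
    have h1 := (ih hl.2 fun q hq' => hlS q (List.mem_cons_of_mem _ hq')).sub_gammaOp hq (hS p hp)
      (hSf p hp) 1
    have h2 : ∀ d, weight n S l.toFinset ∅ d - 1 / p * weight n S l.toFinset ∅ (p * d) =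
        weight n S (p :: l).toFinset ∅ d := fun d => by
      rw [List.toFinset_cons]
      exact weight_plus hS hp (by simpa using hl.1) d
    simp only [h2] at h1
    convert h1 using 1
    · rw [List.foldr_cons, plusOp, one_mul]
    · rw [List.map_cons, List.prod_cons]; ring

lemma HasDiagExpansions.minusOp_foldr {γ : SL(2, ℤ)} {g : ℍ → ℂ} {A : ℂ} {n : ℕ}
    {S T : Finset ℕ} (H : HasDiagExpansions χ γ g 0 A (weight n S T ∅)) (hq : χ.IsQuadratic)
    (hS : ∀ q ∈ S, q.Prime) (hSf : ∀ q ∈ S, q.Coprime f) (l : List ℕ) (hl : l.Nodup)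
    (hlS : ∀ p ∈ l, p ∈ S) :
    HasDiagExpansions χ γ (l.foldr (minusOp χ) g) 0 A (weight n S T l.toFinset) := by
  induction l with
  | nil => simpa using H
  | cons p l ih =>
    rw [List.nodup_cons] at hl
    have hp := hlS p List.mem_cons_self
    have h1 := (ih hl.2 fun q hq' => hlS q (List.mem_cons_of_mem _ hq')).sub_gammaOp hq (hS p hp)
      (hSf p hp) (p : ℂ)⁻¹
    have h2 : ∀ d, weight n S T l.toFinset d - (p : ℂ)⁻¹ / p * weight n S T l.toFinset (p * d) =
        weight n S T (p :: l).toFinset d := fun d => by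
      rw [List.toFinset_cons, ← weight_minus hS hp (by simpa using hl.1) d]
      congr 2
      ring
    simp only [h2] at h1
    convert h1 using 1
    · rw [List.foldr_cons, minusOp, hq.inv]
    · ring

/-- The J₂(f) of `sum_char_gcd_sq` is absorbed into n_χ by `nConst_eq`; with no operator applied the
weight is just gcd(d, c)². -/
lemma hasDiagExpansions_EPrim [NeZero f] (hχ : χ.IsPrimitive) (hq : χ.IsQuadratic)
    (hf : Squarefree f) (γ : SL(2, ℤ)) (S : Finset ℕ) :
    HasDiagExpansions χ γ (EPrim χ)
      (∑ u ∈ Finset.range f, (gauss χ)⁻¹ * χ (u : ZMod f) * (1 / (8 * Real.pi)))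
      (if Int.gcd (γ 1 0) ((f : ℤ) ^ 2) = f then
        nConst χ * (χ (γ 0 0 : ZMod f) * χ ((γ 1 0 / f : ℤ) : ZMod f)) else 0)
      (weight (γ 1 0).natAbs S ∅ ∅) := by
  intro d hd hdf
  have hfR : (f : ℝ) ≠ 0 := by exact_mod_cast NeZero.ne f
  have hfC : (f : ℂ) ≠ 0 := by exact_mod_cast NeZero.ne f
  have hdC : (d : ℂ) ≠ 0 := by exact_mod_cast hd
  have hac : IsCoprime (γ 0 0) (γ 1 0) := by
    have := γ.det_coe
    rw [Matrix.det_fin_two] at this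
    exact ⟨γ 1 1, -γ 0 1, by linear_combination this⟩
  rw [EPrim_eq hχ hq hfR, SlashAction.sum_slash]
  simp_rw [smul_slash_diagGL_mul]
  have H := HasExpansion.sum (Finset.range f) fun u _ =>
    (hasExpansion_eisStar_trans_diag f u d hfR hd γ).smul ((gauss χ)⁻¹ * χ (u : ZMod f))
  convert H using 1
  have h1 : ∀ u ∈ Finset.range f, (gauss χ)⁻¹ * χ (u : ZMod f) *
      (-1 / 24 * ((Int.gcd (f * (d * γ 0 0) + u * γ 1 0) (f * γ 1 0) : ℂ) ^ 2 /
        ((f : ℂ) ^ 2 * d))) =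
      (gauss χ)⁻¹ * (-1 / 24) / ((f : ℂ) ^ 2 * d) *
        (χ (u : ZMod f) * (Int.gcd (f * (d * γ 0 0) + u * γ 1 0) (f * γ 1 0) : ℂ) ^ 2) := by
    intro u _; ring
  rw [Finset.sum_congr rfl h1, ← Finset.mul_sum, sum_char_gcd_sq hχ hq hf hdf hac, nConst_eq hχ hq]
  have h2 : weight (γ 1 0).natAbs S ∅ ∅ d = (Int.gcd d (γ 1 0) : ℂ) ^ 2 := by
    simp [weight, localFactor, Int.gcd_def]
  rw [h2]
  split_ifs
  · push_cast
    rw [map_mul]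
    field_simp
  · ring

end characters

lemma prime_not_dvd_of_dvd_div {D f p : ℕ} (hD : Squarefree D) (hf : f ∣ D) (hp : p.Prime)
    (h : p ∣ D / f) : ¬ p ∣ f := by
  intro hpf
  have h1 := mul_dvd_mul h hpf
  rw [Nat.div_mul_cancel hf] at h1
  exact hp.one_lt.ne' (Nat.isUnit_iff.mp (hD p h1))

lemma prime_dvd_div_iff {D f p : ℕ} (hD : Squarefree D) (hf : f ∣ D) (hp : p.Prime) :
    p ∣ D / f ↔ p ∣ D ∧ ¬ p ∣ f := by
  constructor
  · intro h
    exact ⟨h.trans (Nat.div_dvd_of_dvd hf), prime_not_dvd_of_dvd_div hD hf hp h⟩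
  · rintro ⟨h1, h2⟩
    rw [← Nat.div_mul_cancel hf] at h1
    exact (hp.dvd_mul.mp h1).resolve_right h2

/-- Expansions of the stabilised Eisenstein series at all cusps. -/
theorem hasExpansion_stabilised {f : ℕ} [NeZero f] {χ : DirichletCharacter ℂ f}
    (hχ : χ.IsPrimitive) (hq : χ.IsQuadratic) {D M L : ℕ} (hD : Squarefree D) (hM : M ∣ D)
    (hL : L ∣ D) (hfM : f ∣ M) (hfL : f ∣ L) (hM1 : M ≠ 1) (γ : SL(2, ℤ)) :
    HasExpansion ((minusOpProd χ (L / f) (plusOpProd χ (M / f) (EPrim χ))) ∣[(2 : ℤ)] γ) 0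
      ((if Int.gcd (γ 1 0) ((f : ℤ) ^ 2) = f then
        nConst χ * (χ (γ 0 0 : ZMod f) * χ ((γ 1 0 / f : ℤ) : ZMod f)) else 0) *
        ∏ q ∈ (D / f).primeFactors,
          localFactor (γ 1 0).natAbs (M / f).primeFactors (L / f).primeFactors q 1) := by
  have hfD : f ∣ D := hfM.trans hM
  have hf : Squarefree f := hD.squarefree_of_dvd hfD
  have hD0 : D / f ≠ 0 := fun h => hD.ne_zero (by
    have := Nat.div_mul_cancel hfD
    rw [h, zero_mul] at this
    exact this.symm)
  set S := (D / f).primeFactors with hSdef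
  have hS : ∀ q ∈ S, q.Prime := fun q hq' => Nat.prime_of_mem_primeFactors hq'
  have hSf : ∀ q ∈ S, q.Coprime f := fun q hq' =>
    (hS q hq').coprime_iff_not_dvd.mpr
      (prime_not_dvd_of_dvd_div hD hfD (hS q hq') (Nat.dvd_of_mem_primeFactors hq'))
  have hsub : ∀ K : ℕ, K ∣ D → f ∣ K → (K / f).primeFactorsList.Nodup ∧
      ∀ p ∈ (K / f).primeFactorsList, p ∈ S := by
    intro K hK hfK
    have hKsq : Squarefree (K / f) := (hD.squarefree_of_dvd hK).squarefree_of_dvd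
      (Nat.div_dvd_of_dvd hfK)
    refine ⟨(Nat.squarefree_iff_nodup_primeFactorsList hKsq.ne_zero).mp hKsq, fun p hp => ?_⟩
    rw [hSdef, Nat.mem_primeFactors]
    exact ⟨Nat.prime_of_mem_primeFactorsList hp,
      (Nat.dvd_of_mem_primeFactorsList hp).trans (Nat.div_dvd_div hfK hK), hD0⟩
  have h0 := hasDiagExpansions_EPrim hχ hq hf γ S
  have h1 := h0.plusOp_foldr hq hS hSf _ (hsub M hM hfM).1 (hsub M hM hfM).2
  -- The nonholomorphic part disappears: through ∑ χ(u) = 0 if f ≠ 1, and through a prime p ∣ M with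
  -- 1 - χ(p) = 0 if f = 1. This is where M ≠ 1 enters.
  have hκ : ((M / f).primeFactorsList.map fun p : ℕ => 1 - χ (p : ZMod f)).prod *
      ∑ u ∈ Finset.range f, (gauss χ)⁻¹ * χ (u : ZMod f) * (1 / (8 * Real.pi)) = 0 := by
    by_cases hf1 : f = 1
    · subst hf1
      obtain ⟨p, hp, hpM⟩ := Nat.exists_prime_and_dvd hM1
      rw [List.prod_eq_zero, zero_mul]
      rw [List.mem_map]
      refine ⟨p, ?_, ?_⟩
      · rw [Nat.mem_primeFactorsList (by simpa using ne_zero_of_dvd_ne_zero hD.ne_zero hM)]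
        exact ⟨hp, by simpa using hpM⟩
      · rw [DirichletCharacter.level_one χ, Subsingleton.elim (p : ZMod 1) 1, map_one, sub_self]
    · rw [← Finset.sum_mul, ← Finset.mul_sum, sum_char_range hχ hf1]
      simp
  rw [hκ] at h1
  have h2 := h1.minusOp_foldr hq hS hSf _ (hsub L hL hfL).1 (hsub L hL hfL).2
  have h3 := h2 1 (by simp) (Nat.coprime_one_left f)
  have hone : diagGL 1 (by simp) * mapGL ℝ γ = mapGL ℝ γ := by
    have : diagGL 1 (by simp) = 1 := by
      apply Units.ext
      change !![((1 : ℕ) : ℝ), 0; 0, 1] = 1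
      rw [Nat.cast_one, Matrix.one_fin_two]
    rw [this, one_mul]
  rw [hone] at h3
  have hw : weight (γ 1 0).natAbs S (M / f).primeFactors (L / f).primeFactors 1 =
      ∏ q ∈ S, localFactor (γ 1 0).natAbs (M / f).primeFactors (L / f).primeFactors q 1 := by
    simp [weight]
  rw [← hw]
  convert h3 using 2
  · rfl
  · rw [Nat.cast_one, Nat.cast_one, map_one, div_one, one_mul]
    rfl

/-! ### Dependence on the matrix representing a cusp -/

/-- Both fractions are in lowest terms, so numerators and denominators agree up to a common sign. -/
lemma cusp_lowest_terms {γ : SL(2, ℤ)} {x c₀ : ℤ} (hc₀ : c₀ ≠ 0) (hx : IsCoprime x c₀)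
    (h : (mapGL ℚ γ : GL (Fin 2) ℚ) • (∞ : OnePoint ℚ) = (((x : ℚ) / c₀ : ℚ) : OnePoint ℚ)) :
    ∃ ε : ℤ, ε * ε = 1 ∧ γ 0 0 = ε * x ∧ γ 1 0 = ε * c₀ := by
  rw [smul_infty_eq_ite] at h
  have h00 : (mapGL ℚ γ : GL (Fin 2) ℚ) 0 0 = (γ 0 0 : ℚ) := rfl
  have h10 : (mapGL ℚ γ : GL (Fin 2) ℚ) 1 0 = (γ 1 0 : ℚ) := rfl
  rw [h00, h10] at h
  split_ifs at h with h0
  · exact absurd h (OnePoint.infty_ne_coe _)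
  · have h1 : (γ 0 0 : ℚ) / γ 1 0 = x / c₀ := OnePoint.coe_injective h
    have hc : (c₀ : ℚ) ≠ 0 := by exact_mod_cast hc₀
    rw [div_eq_div_iff h0 hc] at h1
    have h2 : γ 0 0 * c₀ = x * γ 1 0 := by exact_mod_cast h1
    have hac : IsCoprime (γ 0 0) (γ 1 0) := by
      have := γ.det_coe
      rw [Matrix.det_fin_two] at this
      exact ⟨γ 1 1, -γ 0 1, by linear_combination this⟩
    have d1 : c₀ ∣ γ 1 0 := hx.symm.dvd_of_dvd_mul_left (Dvd.intro_left _ h2)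
    have d2 : γ 1 0 ∣ c₀ := hac.symm.dvd_of_dvd_mul_left (Dvd.intro_left _ h2.symm)
    rcases Int.associated_iff.mp (associated_of_dvd_dvd d1 d2) with h3 | h3
    · refine ⟨1, by norm_num, ?_, by rw [h3]; ring⟩
      rw [← h3] at h2
      linarith [mul_right_cancel₀ hc₀ h2]
    · refine ⟨-1, by norm_num, ?_, by rw [h3]; ring⟩
      have h4 : γ 1 0 = -c₀ := by rw [h3]; ring
      rw [h4] at h2
      apply mul_right_cancel₀ hc₀
      linear_combination h2

section gamma0

variable {N : ℕ} {γ δ : SL(2, ℤ)} {x c₀ : ℤ} {ε : ℤ}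

lemma gamma0_mul_entries (γ δ : SL(2, ℤ)) :
    (δ * γ) 0 0 = δ 0 0 * γ 0 0 + δ 0 1 * γ 1 0 ∧ (δ * γ) 1 0 = δ 1 0 * γ 0 0 + δ 1 1 * γ 1 0 := by
  constructor <;> simp [Matrix.mul_apply, Fin.sum_univ_two]

/-- Modulo m ∣ N the lower left entry of δγ is δ₁₁ times that of γ, and δ₁₁ is a unit. -/
lemma dvd_lower_left_iff (hδ : δ ∈ CongruenceSubgroup.Gamma0 N) (hε : ε * ε = 1)
    (hc : (δ * γ) 1 0 = ε * c₀) {m : ℕ} (hm : m ∣ N) : (m : ℤ) ∣ γ 1 0 ↔ (m : ℤ) ∣ c₀ := by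
  have h10 : (m : ℤ) ∣ δ 1 0 := by
    rw [CongruenceSubgroup.Gamma0_mem, ZMod.intCast_zmod_eq_zero_iff_dvd] at hδ
    exact (Int.natCast_dvd_natCast.mpr hm).trans hδ
  have hcop : IsCoprime (m : ℤ) (δ 1 1) := by
    have := δ.det_coe
    rw [Matrix.det_fin_two] at this
    obtain ⟨k, hk⟩ := h10
    exact ⟨-δ 0 1 * k, δ 0 0, by rw [hk] at this; linear_combination this⟩
  rw [(gamma0_mul_entries γ δ).2] at hc
  have hc₀ : c₀ = ε * (δ 1 0 * γ 0 0) + ε * δ 1 1 * γ 1 0 := by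
    linear_combination (-c₀) * hε - ε * hc
  constructor
  · intro h
    rw [hc₀]
    exact dvd_add ((h10.mul_right _).mul_left _) (h.mul_left _)
  · intro h
    have : (m : ℤ) ∣ δ 1 1 * γ 1 0 := by
      rw [show δ 1 1 * γ 1 0 = ε * c₀ - δ 1 0 * γ 0 0 by linear_combination hc]
      exact dvd_sub (h.mul_left _) (h10.mul_right _)
    exact hcop.dvd_of_dvd_mul_left this

/-- Since f² ∣ δ₁₀ and f ∣ c, passing to δγ multiplies a by δ₀₀ and c/f by δ₁₁ modulo f, with δ₀₀δ₁₁
≡ 1; the sign ε occurs squared. -/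
lemma char_cusp_eq {f : ℕ} [NeZero f] {χ : DirichletCharacter ℂ f}
    (hδ : δ ∈ CongruenceSubgroup.Gamma0 N) (hε : ε * ε = 1)
    (ha : (δ * γ) 0 0 = ε * x) (hc : (δ * γ) 1 0 = ε * c₀) (hN : f ^ 2 ∣ N)
    (hfc : (f : ℤ) ∣ γ 1 0) :
    χ (γ 0 0 : ZMod f) * χ ((γ 1 0 / f : ℤ) : ZMod f) =
      χ (x : ZMod f) * χ ((c₀ / f : ℤ) : ZMod f) := by
  have hfz : (f : ℤ) ≠ 0 := by exact_mod_cast NeZero.ne f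
  obtain ⟨c', hc'⟩ := hfc
  have h10 : ((f : ℤ) ^ 2) ∣ δ 1 0 := by
    rw [CongruenceSubgroup.Gamma0_mem, ZMod.intCast_zmod_eq_zero_iff_dvd] at hδ
    exact (by exact_mod_cast hN : ((f : ℤ) ^ 2) ∣ N).trans hδ
  obtain ⟨k, hk⟩ := h10
  have hdet := δ.det_coe
  rw [Matrix.det_fin_two, hk] at hdet
  rw [(gamma0_mul_entries γ δ).1, hc'] at ha
  rw [(gamma0_mul_entries γ δ).2, hc', hk] at hc
  have hc₀ : c₀ = f * (ε * (f * k * γ 0 0 + δ 1 1 * c')) := by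
    linear_combination (-c₀) * hε - ε * hc
  have hx : x = ε * (δ 0 0 * γ 0 0 + δ 0 1 * (f * c')) := by
    linear_combination (-x) * hε - ε * ha
  rw [hc', Int.mul_ediv_cancel_left _ hfz, hc₀, Int.mul_ediv_cancel_left _ hfz, hx]
  have hε' : (ε : ZMod f) * ε = 1 := by exact_mod_cast congrArg (Int.cast : ℤ → ZMod f) hε
  have hdet' : (δ 0 0 : ZMod f) * δ 1 1 = 1 := by
    have := congrArg (Int.cast : ℤ → ZMod f) hdet
    push_cast at this
    rw [ZMod.natCast_self] at this
    linear_combination this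
  rw [← map_mul, ← map_mul]
  congr 1
  push_cast
  rw [ZMod.natCast_self]
  linear_combination (-(γ 0 0 : ZMod f) * c') * hdet' -
    ((δ 0 0 : ZMod f) * δ 1 1 * γ 0 0 * c') * hε'

end gamma0

/-! ### Local factors at the given cusp -/

lemma prod_primeFactors_eq_prod_ite {m n : ℕ} (hn : n ≠ 0) (hmn : m ∣ n) (F : ℕ → ℂ) :
    ∏ q ∈ m.primeFactors, F q = ∏ q ∈ n.primeFactors, if q ∣ m then F q else 1 := by
  rw [← Finset.prod_filter]
  refine Finset.prod_congr ?_ fun _ _ => rfl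
  ext q
  have hm : m ≠ 0 := ne_zero_of_dvd_ne_zero hn hmn
  simp only [Finset.mem_filter, Nat.mem_primeFactors]
  constructor
  · rintro ⟨h1, h2, -⟩
    exact ⟨⟨h1, h2.trans hmn, hn⟩, h2⟩
  · rintro ⟨⟨h1, -, -⟩, h2⟩
    exact ⟨h1, h2, hm⟩

lemma squarefree_cast_eq_prod {n : ℕ} (hn : Squarefree n) :
    (n : ℂ) = ∏ q ∈ n.primeFactors, (q : ℂ) := by
  rw [← Nat.cast_prod, Nat.prod_primeFactors_of_squarefree hn]

lemma squarefree_totient_eq_prod {n : ℕ} (hn : Squarefree n) :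
    (Nat.totient n : ℂ) = ∏ q ∈ n.primeFactors, ((q : ℂ) - 1) := by
  have h := Nat.totient_mul_prod_primeFactors n
  rw [Nat.prod_primeFactors_of_squarefree hn, mul_comm] at h
  rw [Nat.eq_of_mul_eq_mul_left (Nat.pos_of_ne_zero hn.ne_zero) h, Nat.cast_prod]
  refine Finset.prod_congr rfl fun q hq => ?_
  rw [Nat.cast_sub (Nat.prime_of_mem_primeFactors hq).one_le, Nat.cast_one]

lemma squarefree_neg_one_pow_nu {n : ℕ} (hn : Squarefree n) :
    (-1 : ℂ) ^ nu n = ∏ _q ∈ n.primeFactors, (-1 : ℂ) := by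
  rw [Finset.prod_const, nu, (ArithmeticFunction.cardDistinctFactors_eq_cardFactors_iff_squarefree
    hn.ne_zero).mpr hn |>.symm]
  rfl

lemma exists_prime_of_not_dvd {n m : ℕ} (hn : Squarefree n) (h : ¬ n ∣ m) :
    ∃ p : ℕ, p.Prime ∧ p ∣ n ∧ ¬ p ∣ m := by
  by_contra! h'
  apply h
  have := dvd_of_squarefree_of_primes (c := (m : ℤ)) hn fun p hp hpn =>
    Int.natCast_dvd_natCast.mpr (h' p hp hpn)
  exact Int.natCast_dvd_natCast.mp this

/-- The combinatorial data attached to the cusp `x / c₀` with `r s² t c₀ = D C`. -/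
lemma cusp_denominator {D C r s t : ℕ} (hD : Squarefree D) (hC : C ∣ D) (hr : r ∣ D / C)
    (hs : s ∣ C) (ht : t ∣ C) (hst : Nat.Coprime s t) :
    ∃ c₀ : ℕ, D * C = r * s ^ 2 * t * c₀ ∧ c₀ ∣ D * C ∧
      (∀ p : ℕ, p.Prime → p ∣ D → (p ∣ c₀ ↔ ¬ p ∣ r * s)) ∧
      (∀ p : ℕ, p.Prime → p ∣ C → (p ^ 2 ∣ c₀ ↔ ¬ p ∣ s * t)) ∧
      (∀ p : ℕ, p.Prime → p ∣ C → ¬ p ∣ r) ∧ r * s ∣ D := by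
  obtain ⟨r', hr'⟩ := hr
  obtain ⟨w, hw⟩ := Nat.Coprime.mul_dvd_of_dvd_of_dvd hst hs ht
  have hDe : D = r * r' * (s * t * w) := by
    rw [← Nat.div_mul_cancel hC, hr', ← hw]
  have hexcl : ∀ p : ℕ, p.Prime → ∀ a b : ℕ, a * b ∣ D → p ∣ a → ¬ p ∣ b := by
    intro p hp a b hab ha hb
    exact hp.one_lt.ne' (Nat.isUnit_iff.mp (hD p ((mul_dvd_mul ha hb).trans hab)))
  have key : ∀ p : ℕ, p.Prime → p ∣ C → ¬ p ∣ r ∧ ¬ p ∣ r' := by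
    intro p hp hpC
    constructor
    · exact hexcl p hp C r ⟨r', by rw [hDe, hw]; ring⟩ hpC
    · exact hexcl p hp C r' ⟨r, by rw [hDe, hw]; ring⟩ hpC
  -- Here C = stw and D = rr'C, so dividing DC by rs²t leaves r't w²; square-freeness makes the
  -- letters pairwise coprime.
  refine ⟨r' * t * w ^ 2, by rw [hDe, hw]; ring, ⟨r * s ^ 2 * t, by rw [hDe, hw]; ring⟩, ?_, ?_,
    fun p hp hpC => (key p hp hpC).1, ⟨r' * (t * w), by rw [hDe]; ring⟩⟩
  · intro p hp hpD
    rw [hDe] at hpD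
    have e1 := hexcl p hp (r * s) (r' * t * w) ⟨1, by rw [hDe]; ring⟩
    have e2 : p ∣ r' * t * w ^ 2 ↔ p ∣ r' * t * w := by
      rw [hp.dvd_mul, hp.dvd_mul (n := w), hp.prime.dvd_pow_iff_dvd two_ne_zero]
    rw [e2]
    have e3 : p ∣ (r * s) * (r' * t * w) := by
      rw [show (r * s) * (r' * t * w) = r * r' * (s * t * w) by ring]; exact hpD
    constructor
    · intro h h'; exact e1 h' h
    · intro h; exact (hp.dvd_mul.mp e3).resolve_left h
  · intro p hp hpC
    have hpr' := (key p hp hpC).2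
    have e1 := hexcl p hp (s * t) w ⟨r * r', by rw [hDe]; ring⟩
    have e2 := hexcl p hp t w ⟨r * r' * s, by rw [hDe]; ring⟩
    constructor
    · intro h hst'
      have hpw := e1 hst'
      have hc1 : Nat.Coprime (p ^ 2) (w ^ 2) :=
        Nat.Coprime.pow 2 2 (hp.coprime_iff_not_dvd.mpr hpw)
      have hc2 : Nat.Coprime (p ^ 2) r' := Nat.Coprime.pow_left 2 (hp.coprime_iff_not_dvd.mpr hpr')
      have h3 : p ^ 2 ∣ t := hc2.dvd_of_dvd_mul_left (hc1.dvd_of_dvd_mul_right h)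
      have h4 : p * p ∣ D := (pow_two p ▸ h3).trans (ht.trans hC)
      exact hp.one_lt.ne' (Nat.isUnit_iff.mp (hD p h4))
    · intro h
      rw [hw] at hpC
      exact (pow_dvd_pow_of_dvd ((hp.dvd_mul.mp hpC).resolve_left h) 2).mul_left _

lemma localFactor_one {n q : ℕ} (hq : q.Prime) (A B : Finset ℕ) :
    localFactor n A B q 1 =
      1 - (if q ∈ A then (if q ∣ n then (q : ℂ) ^ 2 else 1) / q else 0)
        - (if q ∈ B then (if q ∣ n then (q : ℂ) ^ 2 else 1) / (q : ℂ) ^ 2 else 0)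
        + if q ∈ A ∧ q ∈ B then (if q ∣ n then (q : ℂ) ^ 2 else 1) *
          (if q ^ 2 ∣ n then (q : ℂ) ^ 2 else 1) / (q : ℂ) ^ 3 else 0 := by
  rw [localFactor, gcdRatio_one, mul_one, gcdRatio_self hq]

/-- The product of the local factors at a cusp where the constant term does not vanish. -/
lemma prod_localFactor_eq {D M L f r s t n : ℕ} (hD : Squarefree D) (hM : M ∣ D) (hL : L ∣ D)
    (hfM : f ∣ M) (hfL : f ∣ L) (hDML : D ∣ M * L) (hrs : r * s ∣ D) (hfrs : Nat.Coprime f (r * s))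
    (hn1 : ∀ p : ℕ, p.Prime → p ∣ D → (p ∣ n ↔ ¬ p ∣ r * s))
    (hn2 : ∀ p : ℕ, p.Prime → p ∣ M → p ∣ L → (p ^ 2 ∣ n ↔ ¬ p ∣ s * t))
    (hr : ∀ p : ℕ, p.Prime → p ∣ M → p ∣ L → ¬ p ∣ r)
    (hMLst : Nat.gcd M L ∣ s * t) (hDM : D / M ∣ r * s) :
    ∏ q ∈ (D / f).primeFactors, localFactor n (M / f).primeFactors (L / f).primeFactors q 1 =
      (Nat.totient (D / f) : ℂ) * (mu (L / f) : ℂ) / ((L / f : ℕ) : ℂ) *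
        ((-1) ^ nu (D / (f * r * s)) / ((r : ℂ) * s) *
          ∏ p ∈ (Nat.gcd s (Nat.gcd M L / f)).primeFactors, (1 - 1 / (p : ℂ))) := by
  have hfD : f ∣ D := hfM.trans hM
  have hf0 : 0 < f := Nat.pos_of_ne_zero (ne_zero_of_dvd_ne_zero hD.ne_zero hfD)
  have hDf : Squarefree (D / f) := hD.squarefree_of_dvd (Nat.div_dvd_of_dvd hfD)
  have hLf : L / f ∣ D / f := Nat.div_dvd_div hfL hL
  have hMsq : Squarefree M := hD.squarefree_of_dvd hM
  have hLsq : Squarefree L := hD.squarefree_of_dvd hL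
  have hfrsD : f * (r * s) ∣ D := hfrs.mul_dvd_of_dvd_of_dvd hfD hrs
  have hrsDf : r * s ∣ D / f := by
    rw [Nat.dvd_div_iff_mul_dvd hfD]; exact hfrsD
  have hE : D / (f * r * s) = D / f / (r * s) := by rw [Nat.div_div_eq_div_mul, mul_assoc]
  have hEsq : Squarefree (D / f / (r * s)) := hDf.squarefree_of_dvd (Nat.div_dvd_of_dvd hrsDf)
  have hEdvd : D / f / (r * s) ∣ D / f := Nat.div_dvd_of_dvd hrsDf
  have hfg : f ∣ Nat.gcd M L := Nat.dvd_gcd hfM hfL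
  have hG : Nat.gcd s (Nat.gcd M L / f) ∣ D / f :=
    (Nat.gcd_dvd_right _ _).trans (Nat.div_dvd_div hfg ((Nat.gcd_dvd_left M L).trans hM))
  have hmu : (mu (L / f) : ℂ) = ∏ q ∈ (L / f).primeFactors, ((q : ℂ) + 1) := by
    rw [mu]; push_cast; rfl
  rw [hE, hmu, squarefree_totient_eq_prod hDf,
    squarefree_cast_eq_prod (hDf.squarefree_of_dvd hLf), squarefree_neg_one_pow_nu hEsq,
    ← Nat.cast_mul r s, squarefree_cast_eq_prod (hD.squarefree_of_dvd hrs),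
    prod_primeFactors_eq_prod_ite hDf.ne_zero hLf, prod_primeFactors_eq_prod_ite hDf.ne_zero hLf,
    prod_primeFactors_eq_prod_ite hDf.ne_zero hEdvd, prod_primeFactors_eq_prod_ite hDf.ne_zero hrsDf,
    prod_primeFactors_eq_prod_ite hDf.ne_zero hG, ← Finset.prod_mul_distrib,
    ← Finset.prod_div_distrib, ← Finset.prod_div_distrib, ← Finset.prod_mul_distrib,
    ← Finset.prod_mul_distrib]
  refine Finset.prod_congr rfl fun q hq => ?_
  obtain ⟨hqp, hqDf, -⟩ := Nat.mem_primeFactors.mp hq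
  have hq0 : (q : ℂ) ≠ 0 := by exact_mod_cast hqp.ne_zero
  obtain ⟨hqD, hqf⟩ := (prime_dvd_div_iff hD hfD hqp).mp hqDf
  have mM : q ∈ (M / f).primeFactors ↔ q ∣ M := by
    have h0 : M / f ≠ 0 := (Nat.div_pos (Nat.le_of_dvd (Nat.pos_of_ne_zero hMsq.ne_zero) hfM) hf0).ne'
    rw [Nat.mem_primeFactors, prime_dvd_div_iff hMsq hfM hqp]; tauto
  have mL : q ∈ (L / f).primeFactors ↔ q ∣ L := by
    have h0 : L / f ≠ 0 := (Nat.div_pos (Nat.le_of_dvd (Nat.pos_of_ne_zero hLsq.ne_zero) hfL) hf0).ne'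
    rw [Nat.mem_primeFactors, prime_dvd_div_iff hLsq hfL hqp]; tauto
  have mL' : q ∣ L / f ↔ q ∣ L := by rw [prime_dvd_div_iff hLsq hfL hqp]; tauto
  have mE : q ∣ D / f / (r * s) ↔ ¬ q ∣ r * s := by
    rw [prime_dvd_div_iff hDf hrsDf hqp]; tauto
  have mG : q ∣ Nat.gcd s (Nat.gcd M L / f) ↔ q ∣ s ∧ q ∣ M ∧ q ∣ L := by
    rw [Nat.dvd_gcd_iff, prime_dvd_div_iff (hMsq.squarefree_of_dvd (Nat.gcd_dvd_left M L)) hfg hqp,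
      Nat.dvd_gcd_iff]; tauto
  rw [localFactor_one hqp]
  simp only [mM, mL, mL', mE, mG, hn1 q hqp hqD]
  -- Cases by which of M and L contain q. If both do, q ∣ st excludes q² ∣ n, and q ∣ s or q ∤ s
  -- decides whether q ∣ n. If only L does, D/M ∣ rs forces q ∣ rs, hence q ∤ n.
  have hML : q ∣ M ∨ q ∣ L := hqp.dvd_mul.mp (hqD.trans hDML)
  by_cases hqM : q ∣ M
  · by_cases hqL : q ∣ L
    · have h1 := hn2 q hqp hqM hqL
      have h2 := hr q hqp hqM hqL
      have h3 : q ∣ s * t := (Nat.dvd_gcd hqM hqL).trans hMLst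
      have h4 : ¬ q ^ 2 ∣ n := fun h => (h1.mp h) h3
      by_cases hqs : q ∣ s
      · have h5 : q ∣ r * s := hqs.mul_left r
        simp only [hqM, hqL, hqs, h4, h5, if_true, if_false, not_true, and_self]
        field_simp
        ring
      · have h5 : ¬ q ∣ r * s := fun h => (hqp.dvd_mul.mp h).elim h2 hqs
        simp only [hqM, hqL, hqs, h4, h5, if_true, if_false, not_false_eq_true, and_self, false_and]
        field_simp
        ring
    · by_cases h5 : q ∣ r * s
      · simp only [hqM, hqL, h5, if_true, if_false, not_true, and_false]
        field_simp
        ring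
      · simp only [hqM, hqL, h5, if_true, if_false, not_false_eq_true, and_false]
        field_simp
        ring
  · have hqL := hML.resolve_left hqM
    have h5 : q ∣ r * s := ((prime_dvd_div_iff hD hM hqp).mpr ⟨hqD, hqM⟩).trans hDM
    simp only [hqM, hqL, h5, if_true, if_false, not_true, and_false, false_and]
    field_simp
    ring

/-- Being quadratic means having square 1, and this descends because raising the level is injective
on characters. -/
lemma primitiveCharacter_isQuadratic {n : ℕ} [NeZero n] {ψ : DirichletCharacter ℂ n}
    (hψ : ψ.IsQuadratic) : ψ.primitiveCharacter.IsQuadratic := by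
  rw [MulChar.isQuadratic_iff_sq_eq_one] at hψ ⊢
  apply DirichletCharacter.changeLevel_injective (DirichletCharacter.conductor_dvd_level ψ)
  rw [map_pow, map_one, DirichletCharacter.changeLevel_primitiveCharacter, hψ]

/-- Constant terms at the cusps of the stabilised Eisenstein series attached to a primitive
quadratic character. -/
theorem isConstantTermAt_stabilised {D C M L f : ℕ} [NeZero f] {χ : DirichletCharacter ℂ f}
    (hχ : χ.IsPrimitive) (hq : χ.IsQuadratic) (hD : Squarefree D) (hC : C ∣ D)
    (hML : IsIndexPair D C M L) (hfML : f ∣ Nat.gcd M L) {r s t : ℕ} (hr : r ∣ D / C)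
    (hs : s ∣ C) (ht : t ∣ C) (hst : Nat.Coprime s t) {x : ℤ} (hx : IsCoprime x (D : ℤ)) :
    IsConstantTermAt (D * C) (minusOpProd χ (L / f) (plusOpProd χ (M / f) (EPrim χ)))
      (((r * s ^ 2 * t : ℕ) : ℚ) * (x : ℚ) / ((D * C : ℕ) : ℚ))
      (if Nat.Coprime s f ∧ Nat.gcd M L ∣ s * t ∧ D / M ∣ r * s then
        nConst χ * (((Nat.totient (D / f) : ℂ) * (mu (L / f) : ℂ)) / ((L / f : ℕ) : ℂ)) *
          cConst χ D C M L r s t x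
      else 0) := by
  rintro γ ⟨δ, hδ, hcusp⟩
  obtain ⟨hM, hL, hM1, hDML, hMLDC⟩ := hML
  have hfM : f ∣ M := hfML.trans (Nat.gcd_dvd_left M L)
  have hfL : f ∣ L := hfML.trans (Nat.gcd_dvd_right M L)
  have hfD : f ∣ D := hfM.trans hM
  have hf : Squarefree f := hD.squarefree_of_dvd hfD
  have hD0 := hD.ne_zero
  have hC0 : C ≠ 0 := ne_zero_of_dvd_ne_zero hD0 hC
  obtain ⟨c₀, hN, hc₀N, hc1, hc2, hCr, hrsD⟩ := cusp_denominator hD hC hr hs ht hst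
  have hN0 : D * C ≠ 0 := mul_ne_zero hD0 hC0
  have hc₀0 : c₀ ≠ 0 := ne_zero_of_dvd_ne_zero hN0 hc₀N
  have hxc : IsCoprime x (c₀ : ℤ) := by
    have h1 : IsCoprime x ((D * C : ℕ) : ℤ) := by
      rw [Nat.cast_mul]
      exact hx.mul_right (hx.of_isCoprime_of_dvd_right (Int.natCast_dvd_natCast.mpr hC))
    exact h1.of_isCoprime_of_dvd_right (Int.natCast_dvd_natCast.mpr hc₀N)
  have hqeq : ((r * s ^ 2 * t : ℕ) : ℚ) * (x : ℚ) / ((D * C : ℕ) : ℚ) = (x : ℚ) / ((c₀ : ℤ) : ℚ) := by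
    have h1 : ((D * C : ℕ) : ℚ) ≠ 0 := by exact_mod_cast hN0
    have h2 : ((c₀ : ℤ) : ℚ) ≠ 0 := by exact_mod_cast hc₀0
    rw [div_eq_div_iff h1 h2, hN]
    push_cast
    ring
  rw [hqeq] at hcusp
  obtain ⟨ε, hε, hγ0, hγ1⟩ := cusp_lowest_terms (by exact_mod_cast hc₀0) hxc hcusp
  -- If p ∤ C, then p² ∣ ML ∣ DC would force p² ∣ D.
  have hpC : ∀ p : ℕ, p.Prime → p ∣ M → p ∣ L → p ∣ C := by
    intro p hp h1 h2
    by_contra h3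
    have h4 : p * p ∣ D := by
      have := (mul_dvd_mul h1 h2).trans hMLDC
      exact (Nat.Coprime.mul_left (hp.coprime_iff_not_dvd.mpr h3)
        (hp.coprime_iff_not_dvd.mpr h3)).dvd_of_dvd_mul_right this
    exact hp.one_lt.ne' (Nat.isUnit_iff.mp (hD p h4))
  have tr : ∀ m : ℕ, m ∣ D * C → (m ∣ (γ 1 0).natAbs ↔ m ∣ c₀) := fun m hm => by
    rw [← Int.natCast_dvd, dvd_lower_left_iff hδ hε hγ1 hm, Int.natCast_dvd_natCast]
  have hn1 : ∀ p : ℕ, p.Prime → p ∣ D → (p ∣ (γ 1 0).natAbs ↔ ¬ p ∣ r * s) := fun p hp hpD =>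
    (tr p (hpD.mul_right C)).trans (hc1 p hp hpD)
  have hn2 : ∀ p : ℕ, p.Prime → p ∣ M → p ∣ L → (p ^ 2 ∣ (γ 1 0).natAbs ↔ ¬ p ∣ s * t) :=
    fun p hp h1 h2 => (tr (p ^ 2) (by
      rw [pow_two]; exact (mul_dvd_mul h1 h2).trans hMLDC)).trans (hc2 p hp (hpC p hp h1 h2))
  obtain ⟨h, hh, a, ha, hsum⟩ :=
    hasExpansion_stabilised hχ hq hD hM hL hfM hfL hM1 γ
  refine ⟨h, hh, a, ?_, fun z => by simpa using hsum z⟩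
  rw [ha]
  split_ifs with hg hcond hcond
  · obtain ⟨hsf, hMLst, hDM⟩ := hcond
    have hfst : f ∣ s * t := hfML.trans hMLst
    have hfrs : Nat.Coprime f (r * s) := by
      refine Nat.Coprime.mul_right (Nat.Coprime.symm (Nat.coprime_of_dvd fun p hp hpr hpf => ?_)) hsf.symm
      exact hCr p hp (hpC p hp (hpf.trans hfM) (hpf.trans hfL)) hpr
    rw [prod_localFactor_eq hD hM hL hfM hfL hDML hrsD hfrs hn1 hn2
      (fun p hp h1 h2 => hCr p hp (hpC p hp h1 h2)) hMLst hDM]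
    have hfc : (f : ℤ) ∣ γ 1 0 := by
      have := Int.gcd_dvd_left (γ 1 0) ((f : ℤ) ^ 2)
      rwa [hg] at this
    rw [char_cusp_eq hδ hε hγ0 hγ1 ((pow_two f ▸ mul_dvd_mul hfM hfL).trans hMLDC) hfc,
      cConst, hq.inv]
    have hdiv : D * C / (f * r * s ^ 2 * t) = c₀ / f := by
      have hpos : 0 < r * s ^ 2 * t := Nat.pos_of_ne_zero fun h0 => hN0 (by rw [hN, h0, zero_mul])
      rw [hN, show f * r * s ^ 2 * t = (r * s ^ 2 * t) * f by ring,
        Nat.mul_div_mul_left _ _ hpos]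
    have hcast : (((c₀ : ℤ) / (f : ℤ) : ℤ) : ZMod f) = ((c₀ / f : ℕ) : ZMod f) := by
      rw [← Int.natCast_ediv]
      exact Int.cast_natCast _
    rw [hdiv, hcast]
    ring
  -- The gcd condition already forces (s, f) = 1 and p ∣ st for all p ∣ f, so one of the two
  -- divisibilities fails at a prime outside f, whose local factor has to vanish.
  · rw [mul_eq_zero]
    right
    rw [gcd_sq_eq_iff hf] at hg
    have hgp : ∀ p : ℕ, p.Prime → p ∣ f → ¬ p ∣ r * s ∧ p ∣ s * t := fun p hp hpf => by
      have h1 := hg p hp hpf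
      rw [Int.natCast_dvd, ← Nat.cast_pow, Int.natCast_dvd, hn1 p hp (hpf.trans hfD),
        hn2 p hp (hpf.trans hfM) (hpf.trans hfL), not_not] at h1
      exact h1
    have hsf : Nat.Coprime s f := Nat.coprime_of_dvd fun p hp hps hpf =>
      (hgp p hp hpf).1 (hps.mul_left r)
    have hDf0 : D / f ≠ 0 :=
      (Nat.div_pos (Nat.le_of_dvd (Nat.pos_of_ne_zero hD0) hfD)
        (Nat.pos_of_ne_zero hf.ne_zero)).ne'
    have hmem : ∀ K : ℕ, K ∣ D → f ∣ K → ∀ p : ℕ, p.Prime → ¬ p ∣ f →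
        (p ∈ (K / f).primeFactors ↔ p ∣ K) := fun K hK hfK p hp hpf => by
      have hK0 := ne_zero_of_dvd_ne_zero hD0 hK
      have h0 : K / f ≠ 0 := (Nat.div_pos (Nat.le_of_dvd (Nat.pos_of_ne_zero hK0) hfK)
        (Nat.pos_of_ne_zero hf.ne_zero)).ne'
      rw [Nat.mem_primeFactors, prime_dvd_div_iff (hD.squarefree_of_dvd hK) hfK hp]
      tauto
    rw [Finset.prod_eq_zero_iff]
    by_cases hst1 : Nat.gcd M L ∣ s * t
    · have hDM : ¬ D / M ∣ r * s := fun h' => hcond ⟨hsf, hst1, h'⟩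
      obtain ⟨p, hp, hpDM, hprs⟩ := exists_prime_of_not_dvd
        (hD.squarefree_of_dvd (Nat.div_dvd_of_dvd hM)) hDM
      obtain ⟨hpD, hpM⟩ := (prime_dvd_div_iff hD hM hp).mp hpDM
      have hpf : ¬ p ∣ f := fun h' => hpM (h'.trans hfM)
      have hpL : p ∣ L := (hp.dvd_mul.mp (hpD.trans hDML)).resolve_left hpM
      -- Only L contains p, and p divides c: the local factor is 1 - p²/p² = 0.
      refine ⟨p, (hmem D dvd_rfl hfD p hp hpf).mpr hpD, ?_⟩
      have hp0 : (p : ℂ) ≠ 0 := by exact_mod_cast hp.ne_zero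
      rw [localFactor_one hp]
      simp only [hmem M hM hfM p hp hpf, hmem L hL hfL p hp hpf, hpM, hpL,
        (hn1 p hp hpD).mpr hprs, if_true, if_false, false_and]
      field_simp
      ring
    · obtain ⟨p, hp, hpg, hpst⟩ := exists_prime_of_not_dvd
        (hD.squarefree_of_dvd ((Nat.gcd_dvd_left M L).trans hM)) hst1
      have hpM := hpg.trans (Nat.gcd_dvd_left M L)
      have hpL := hpg.trans (Nat.gcd_dvd_right M L)
      have hpf : ¬ p ∣ f := fun h' => hpst (hgp p hp h').2
      have h2 := (hn2 p hp hpM hpL).mpr hpst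
      have h1 : p ∣ (γ 1 0).natAbs := (dvd_pow_self p two_ne_zero).trans h2
      -- Both M and L contain p, and p² divides c: the local factor is 1 - p - 1 + p = 0.
      refine ⟨p, (hmem D dvd_rfl hfD p hp hpf).mpr (hpM.trans hM), ?_⟩
      have hp0 : (p : ℂ) ≠ 0 := by exact_mod_cast hp.ne_zero
      rw [localFactor_one hp]
      simp only [hmem M hM hfM p hp hpf, hmem L hL hfL p hp hpf, hpM, hpL, h1, h2, if_true,
        and_self]
      field_simp
      ring
  -- The stated conditions give p ∤ rs and p ∣ st at each p ∣ f, that is v_p(c) = 1, so gcd(c, f²) =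
  -- f after all.
  · exfalso
    obtain ⟨hsf, hMLst, hDM⟩ := hcond
    apply hg
    rw [gcd_sq_eq_iff hf]
    intro p hp hpf
    have hpst : p ∣ s * t := hpf.trans (hfML.trans hMLst)
    have hps : ¬ p ∣ s := fun h' => hp.one_lt.ne' (Nat.dvd_one.mp (hsf ▸ Nat.dvd_gcd h' hpf))
    have hpr := hCr p hp (hpC p hp (hpf.trans hfM) (hpf.trans hfL))
    rw [Int.natCast_dvd, ← Nat.cast_pow, Int.natCast_dvd, hn1 p hp (hpf.trans hfD),
      hn2 p hp (hpf.trans hfM) (hpf.trans hfL), not_not]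
    exact ⟨fun h' => (hp.dvd_mul.mp h').elim hpr hps, hpst⟩
  · rw [zero_mul]

end QuadEis

theorem proposition4
    (D C : ℕ) (hD : Squarefree D) (hC : C ∣ D)
    (M L : ℕ) [NeZero M] [NeZero L] (hML : QuadEis.IsIndexPair D C M L)
    (ψ : DirichletCharacter ℂ (Nat.gcd M L)) (hψ : ψ.IsQuadratic)
    (f : ℕ) (hf : f = ψ.conductor)
    (r s t : ℕ) (hr : r ∣ D / C) (hs : s ∣ C) (ht : t ∣ C) (hst : Nat.Coprime s t)
    (x : ℤ) (hx : IsCoprime x (D : ℤ)) :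
    QuadEis.IsConstantTermAt (D * C) (QuadEis.E M L ψ)
      (((r * s ^ 2 * t : ℕ) : ℚ) * (x : ℚ) / ((D * C : ℕ) : ℚ))
      (if Nat.Coprime s f ∧ Nat.gcd M L ∣ s * t ∧ D / M ∣ r * s then
        QuadEis.nConst ψ.primitiveCharacter *
          (((Nat.totient (D / f) : ℂ) * (QuadEis.mu (L / f) : ℂ)) / ((L / f : ℕ) : ℂ)) *
          QuadEis.cConst ψ.primitiveCharacter D C M L r s t x
      else 0) := by
  subst hf
  exact QuadEis.isConstantTermAt_stabilised ψ.primitiveCharacter_isPrimitive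
    (QuadEis.primitiveCharacter_isQuadratic hψ) hD hC hML ψ.conductor_dvd_level hr hs ht hst hx
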